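/- **Setting.** $K\ge 2$ agents face the same $N$-armed stochastic bandit. The reward of option $i$ has a fixed sub-Gaussian law with mean $\mu_i$ and known variance proxy $\sigma_i^2>0$; rewards are independent over rounds and agents. Let $\mu_{i^*}=\max_i\mu_i$ and $\Delta_i=\mu_{i^*}-\mu_i$. The agents are the vertices of a symmetric multi-star graph $G$ with $m$ centers, $1\le m\le K$: the centers $1,\dots,m$ are pairwise adjacent, each peripheral agent $k>m$ has exactly one neighbor, which is a center, and all centers have the same degree $d_{cen}=\frac{K-m}{m}+m-1$. Let $d_k$ be the degree of agent $k$, $d_{avg}=\frac1K\sum_k d_k$, and $d_k^{avg}$ the average degree of the neighbors of $k$. In every round, each agent receives the choice and reward of each of its neighbors with probability $p\in[0,1]$, independently over these neighbors, and this communication is independent of the past and of the choices and rewards of the round; an agent always observes itself. Let $\varphi^k_t$ be the option chosen by agent $k$ in round $t$, $n_i^k(t)$ the number of times agent $k$ chooses option $i$ in rounds $1,\dots,t$, $N_i^k(t)$ the number of observations (own samples and received broadcasts) of option $i$ by agent $k$ in these rounds, and $\widehat\mu_i^k(t)$ the average of the observed rewards. For $\xi>1$ put $$Q_i^k(t)=\widehat\mu_i^k(t)+\sigma_i\sqrt{\frac{2(1+\alpha_k)(\xi+1)\log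 t}{N_i^k(t)}},\qquad \alpha_k=\begin{cases}p^{1-p}\,\dfrac{d_k-d_k^{avg}}{d_k}, & k\le m,\\ 0, & k>m,\end{cases}$$ with $Q_i^k(t)=+\infty$ if $N_i^k(t)=0$. Under the heterogeneous sampling rules $\varphi^k_{t+1}\in\arg\max_i Q_i^k(t)$ for all $k$ and all $t\ge 0$, ties being broken in any way that depends only on the past (and on independent randomization). By symmetry $\alpha_k=\alpha$ is the same for all centers. The expected cumulative group regret is $\mathbb E(R(T))=\sum_{i=1}^N\sum_{k=1}^K\Delta_i\,\mathbb E(n_i^k(T))$. **Theorem.** There is an absolute constant $\zeta>1$ such that in this setting, for all $\xi>1$ and all $T\ge 1$, $$\mathbb E(R(T))\le c_1(K,m,\alpha,p)\sum_{i:\,\Delta_i>0}\frac{8\sigma_i^2(\xi+1)\log T}{\Delta_i}+\frac{2}{\log\zeta}\sum_{i=1}^N\Delta_i\Bigg(K\log(1+d_{avg})+(K-m)\frac{\xi\log 4+1}{\xi^2 2^{\xi}}+m\,\frac{\log(2(1+d_{cen}))(\xi\alpha+\xi+\alpha)+1}{(\xi\alpha+\xi+\alpha)^2\,2^{\xi\alpha+\xi+\alpha}}\Bigg),$$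 where $$c_1(K,m,\alpha,p)=K-m+\frac{m(1+\alpha)}{1+p(m-1)}\Big[1-p\frac{K-m}{m}\Big]^+,\qquad [x]^+=\max\{x,0\}.$$ -/

import Mathlib

open MeasureTheory ProbabilityTheory
open scoped NNReal

universe u

noncomputable section

namespace MultiStar

/-! ### Symmetric multi-star graphs -/

/-- `G` is a symmetric multi-star graph on the agents `0, …, K - 1` whose center agents are
`0, …, m - 1`: the centers are pairwise adjacent, every peripheral agent has exactly one neighbor
and this neighbor is a center, and all centers have the same number of neighbors. -/
structure IsSymmetricMultiStar {K : ℕ} (G : SimpleGraph (Fin K)) [DecidableRel G.Adj]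
    (m : ℕ) : Prop where
  one_le : 1 ≤ m
  le_card : m ≤ K
  center_adj : ∀ k j : Fin K, k.val < m → j.val < m → k ≠ j → G.Adj k j
  peripheral : ∀ k : Fin K, m ≤ k.val → ∃ c : Fin K, c.val < m ∧ ∀ j, G.Adj k j ↔ j = c
  symmetric : ∀ k j : Fin K, k.val < m → j.val < m → G.degree k = G.degree j

/-- The average degree of the network. -/
def avgDegree {K : ℕ} (G : SimpleGraph (Fin K)) [DecidableRel G.Adj] : ℝ :=
  (∑ k, (G.degree k : ℝ)) / K

/-- The average degree of the neighbors of agent `k`. -/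
def neighborAvgDegree {K : ℕ} (G : SimpleGraph (Fin K)) [DecidableRel G.Adj] (k : Fin K) : ℝ :=
  (∑ j ∈ G.neighborFinset k, (G.degree j : ℝ)) / G.degree k

/-- The exploration bias `α_k` of agent `k`; it vanishes for peripheral agents. -/
def explorationBias {K : ℕ} (G : SimpleGraph (Fin K)) [DecidableRel G.Adj] (m : ℕ) (p : ℝ)
    (k : Fin K) : ℝ :=
  if k.val < m then p ^ (1 - p) * ((G.degree k : ℝ) - neighborAvgDegree G k) / G.degree k else 0

/-! ### The bandit problem -/

/-- The expected reward of option `i`, whose reward distribution is `ν i`. -/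
def meanReward {N : ℕ} (ν : Fin N → Measure ℝ) (i : Fin N) : ℝ := ∫ x, x ∂(ν i)

/-- The expected reward gap between the optimal option and option `i`. -/
def gap {N : ℕ} (ν : Fin N → Measure ℝ) (i : Fin N) : ℝ :=
  (⨆ j, meanReward ν j) - meanReward ν i

/-- The reward distributions are probability measures, and the reward of option `i` is
sub-Gaussian with variance proxy `σ i ^ 2`. -/
structure IsSubgaussianBandit {N : ℕ} (ν : Fin N → Measure ℝ) (σ : Fin N → ℝ≥0) : Prop where
  prob : ∀ i, IsProbabilityMeasure (ν i)
  sigma_pos : ∀ i, 0 < σ i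
  subgaussian : ∀ i, HasSubgaussianMGF (fun x ↦ x - meanReward ν i) (σ i ^ 2) (ν i)

section Interaction

variable {Ω : Type u} {K N : ℕ}

/-- `n_i^k(t)`: the number of times agent `k` chooses option `i` in the rounds `1, …, t`, where
`φ τ k` is the option chosen by agent `k` in round `τ`. -/
def numChoices (φ : ℕ → Fin K → Ω → Fin N) (k : Fin K) (i : Fin N) (t : ℕ) (ω : Ω) : ℕ :=
  ∑ τ ∈ Finset.Icc 1 t, if φ τ k ω = i then 1 else 0

/-- `N_i^k(t)`: the number of observations of option `i` by agent `k` in the rounds `1, …, t`,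
where `I τ k j` tells whether agent `k` receives the information of agent `j` in round `τ`. -/
def numObs (φ : ℕ → Fin K → Ω → Fin N) (I : ℕ → Fin K → Fin K → Ω → Bool)
    (k : Fin K) (i : Fin N) (t : ℕ) (ω : Ω) : ℕ :=
  ∑ τ ∈ Finset.Icc 1 t, ∑ j, if φ τ j ω = i ∧ I τ k j ω = true then 1 else 0

/-- `S_i^k(t)`: the sum of the rewards of option `i` observed by agent `k` in the rounds
`1, …, t`, where `X τ j i` is the reward that option `i` yields to agent `j` in round `τ`. -/
def rewardSum (X : ℕ → Fin K → Fin N → Ω → ℝ) (φ : ℕ → Fin K → Ω → Fin N)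
    (I : ℕ → Fin K → Fin K → Ω → Bool) (k : Fin K) (i : Fin N) (t : ℕ) (ω : Ω) : ℝ :=
  ∑ τ ∈ Finset.Icc 1 t, ∑ j, if φ τ j ω = i ∧ I τ k j ω = true then X τ j i ω else 0

/-- The estimate of the expected reward of option `i` by agent `k` after round `t`. -/
def estimate (X : ℕ → Fin K → Fin N → Ω → ℝ) (φ : ℕ → Fin K → Ω → Fin N)
    (I : ℕ → Fin K → Fin K → Ω → Bool) (k : Fin K) (i : Fin N) (t : ℕ) (ω : Ω) : ℝ :=
  rewardSum X φ I k i t ω / numObs φ I k i t ω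

/-- The uncertainty `C_i^k(t)` with exploration biases `α`. -/
def uncertainty (σ : Fin N → ℝ≥0) (α : Fin K → ℝ) (ξ : ℝ) (φ : ℕ → Fin K → Ω → Fin N)
    (I : ℕ → Fin K → Fin K → Ω → Bool) (k : Fin K) (i : Fin N) (t : ℕ) (ω : Ω) : ℝ :=
  (σ i : ℝ) * √(2 * (1 + α k) * (ξ + 1) * Real.log t / numObs φ I k i t ω)

/-- The objective `Q_i^k(t)`. An option not yet observed by the agent has infinite uncertainty,
hence objective `⊤`. -/
def objective (σ : Fin N → ℝ≥0) (α : Fin K → ℝ) (ξ : ℝ) (X : ℕ → Fin K → Fin N → Ω → ℝ)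
    (φ : ℕ → Fin K → Ω → Fin N) (I : ℕ → Fin K → Fin K → Ω → Bool)
    (k : Fin K) (i : Fin N) (t : ℕ) (ω : Ω) : EReal :=
  if numObs φ I k i t ω = 0 then ⊤
  else ((estimate X φ I k i t ω + uncertainty σ α ξ φ I k i t ω : ℝ) : EReal)

/-- Every agent follows the UCB sampling rules with exploration biases `α`: in round `t + 1` it
chooses an option of maximal objective at time `t` (ties are broken in any way). -/
def FollowsUCB (σ : Fin N → ℝ≥0) (α : Fin K → ℝ) (ξ : ℝ) (X : ℕ → Fin K → Fin N → Ω → ℝ)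
    (φ : ℕ → Fin K → Ω → Fin N) (I : ℕ → Fin K → Fin K → Ω → Bool) : Prop :=
  ∀ (t : ℕ) (k : Fin K) (ω : Ω) (i : Fin N),
    objective σ α ξ X φ I k i t ω ≤ objective σ α ξ X φ I k (φ (t + 1) k ω) t ω

/-- The interaction of `K` agents on the graph `G` with the bandit `ν`, in rounds `1, 2, …`.
`ℱ t` is what has happened up to round `t` (it may contain extra randomization). The choices of
round `t + 1` are determined by `ℱ t`. The rewards of round `t + 1` have the laws `ν i` and are
independent across agents. In each round an agent receives the information of each of its
neighbors with probability `p`, independently over these neighbors; it always has its own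
information and receives none from other agents. Rewards and communication of round `t + 1` are
independent of each other and of `ℱ t`. Nothing is assumed about the dependence between what
different agents receive, so one broadcast coin per sender and one coin per link are both
covered. -/
structure IsBroadcastBandit [mΩ : MeasurableSpace Ω] (P : Measure Ω) (ℱ : Filtration ℕ mΩ)
    (G : SimpleGraph (Fin K)) (p : ℝ) (ν : Fin N → Measure ℝ)
    (X : ℕ → Fin K → Fin N → Ω → ℝ) (φ : ℕ → Fin K → Ω → Fin N)
    (I : ℕ → Fin K → Fin K → Ω → Bool) : Prop where
  choice_measurable : ∀ t k, Measurable[ℱ t] (φ (t + 1) k)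
  reward_measurable : ∀ t k i, Measurable[ℱ (t + 1)] (X (t + 1) k i)
  link_measurable : ∀ t k j, Measurable[ℱ (t + 1)] (I (t + 1) k j)
  reward_law : ∀ t k i, P.map (X (t + 1) k i) = ν i
  reward_indep : ∀ t, iIndepFun (fun (k : Fin K) (ω : Ω) (i : Fin N) ↦ X (t + 1) k i ω) P
  link_self : ∀ t k ω, I (t + 1) k k ω = true
  link_nonadj : ∀ t k j ω, k ≠ j → ¬ G.Adj k j → I (t + 1) k j ω = false
  link_prob : ∀ t k j, G.Adj k j → P.real {ω | I (t + 1) k j ω = true} = p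
  link_indep : ∀ t k, iIndepFun (fun (j : Fin K) (ω : Ω) ↦ I (t + 1) k j ω) P
  reward_link_indep : ∀ t, IndepFun (fun (ω : Ω) (k : Fin K) (i : Fin N) ↦ X (t + 1) k i ω)
    (fun (ω : Ω) (k j : Fin K) ↦ I (t + 1) k j ω) P
  round_indep_past : ∀ t, Indep (ℱ t)
    (MeasurableSpace.comap
      (fun (ω : Ω) ↦ ((fun (k : Fin K) (i : Fin N) ↦ X (t + 1) k i ω),
        (fun (k j : Fin K) ↦ I (t + 1) k j ω))) inferInstance) P

/-- The expected cumulative group regret `E(R(T))`. -/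
def expectedRegret [MeasurableSpace Ω] (P : Measure Ω) (ν : Fin N → Measure ℝ)
    (φ : ℕ → Fin K → Ω → Fin N) (T : ℕ) : ℝ :=
  ∑ i, ∑ k, gap ν i * ∫ ω, (numChoices φ k i T ω : ℝ) ∂P

end Interaction

/-- The constant `c₁(K, m, α, p)`. -/
def c₁ (K m : ℕ) (α p : ℝ) : ℝ :=
  ((K : ℝ) - m) + m * (1 + α) / (1 + p * ((m : ℝ) - 1)) * max (1 - p * (((K : ℝ) - m) / m)) 0

end MultiStar

end

/-! The constant 8 is generous and `ζ` may be chosen extremely close to 1. The lower-order term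
therefore only has to dominate a fixed, huge multiple of `K log (1 + d_avg)`; its other two summands
are nonnegative and are dropped. What remains is the leading constant.

If an agent chooses a suboptimal option `i` with gap `D`, then it has few observations of `i`, or it
underestimates an optimal option, or it overestimates `i` by `D(1 - 1/a)` (`choice_trichotomy`). The
parameter `a > 1` is free: "few" means at most `2a²(1 + α_k)(ξ + 1)σ²/D² · log T`, and `a` near 1
gives almost 2 in place of 8. Underestimation costs `O(log (1 + d_k))` per agent, by dyadic peeling
over the number of observations. Concavity of the logarithm turns the sum of these into `K log (1 +
d_avg)`.

Counting only an agent's own samples as guaranteed observations gives a group total close to `2 ∑ (1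
+ α_k)` times `(ξ + 1)σ²/D² · log T`. This is enough when `∑ (1 + α_k) ≤ 3.9 c₁`, since `2 · 3.9 <
8` (`sum_integral_numChoices_le_of_le`). If there are peripheral agents, equality of the central
degrees gives every center its own peripheral agent. Hence `2m ≤ K`, and with `α_k ≤ 1` one gets `∑
(1 + α_k) ≤ K + m ≤ 3(K - m) ≤ 3 c₁`. If `m = K`, the graph is complete, `α = 0` and `c₁ ≥ K / (1 +
p(K - 1))`, so the bound also holds when `pK ≤ 2.9`.

Only a complete graph with `pK > 2.9` needs the communication
(`sum_integral_numChoices_le_of_complete`). There every agent receives each choice with probability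
at least `p`. After about `b/p` choices by the group, all agents have more than `b` observations, up
to exponentially small probability. The group total is thus about `b/p` and not `Kb`.

All tail bounds come from one exponential supermartingale: choices are predictable, and each round's
rewards and links are independent of the past. -/

namespace MultiStar

open Finset

/-! ### Exponential supermartingales over predictable index sets -/

section ExponentialSupermartingale

variable {Ω : Type*} [mΩ : MeasurableSpace Ω] {P : Measure Ω} {ι : Type*} [Fintype ι]

open scoped Classical in
/-- An independent exponential factor over a random index set does not increase the expectation
if it has expectation at most one over every fixed index set. -/
theorem lintegral_mul_exp_sum_le {ℱ 𝒢 : MeasurableSpace Ω} (hℱ : ℱ ≤ mΩ) (h𝒢 : 𝒢 ≤ mΩ)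
    (hind : Indep ℱ 𝒢 P) {F : Ω → ENNReal} (hF : Measurable[ℱ] F) {J : Ω → Finset ι}
    (hJ : ∀ s, MeasurableSet[ℱ] {ω | J ω = s}) {ψ : ι → Ω → ℝ}
    (hψ : ∀ j, Measurable[𝒢] (ψ j))
    (hone : ∀ s : Finset ι, ∫⁻ ω, ENNReal.ofReal (Real.exp (∑ j ∈ s, ψ j ω)) ∂P ≤ 1) :
    ∫⁻ ω, F ω * ENNReal.ofReal (Real.exp (∑ j ∈ J ω, ψ j ω)) ∂P ≤ ∫⁻ ω, F ω ∂P := by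
  have hEm : ∀ s : Finset ι, Measurable[𝒢] (fun ω ↦
      ENNReal.ofReal (Real.exp (∑ j ∈ s, ψ j ω))) := fun s ↦
    ENNReal.measurable_ofReal.comp (Real.measurable_exp.comp
      (Finset.measurable_fun_sum s fun j _ ↦ hψ j))
  have hFs : ∀ s : Finset ι, Measurable[ℱ] (Set.indicator {ω | J ω = s} F) :=
    fun s ↦ hF.indicator (hJ s)
  calc ∫⁻ ω, F ω * ENNReal.ofReal (Real.exp (∑ j ∈ J ω, ψ j ω)) ∂P
      = ∫⁻ ω, ∑ s : Finset ι, Set.indicator {ω | J ω = s} F ω *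
          ENNReal.ofReal (Real.exp (∑ j ∈ s, ψ j ω)) ∂P := by
        refine lintegral_congr fun ω ↦ ?_
        rw [sum_eq_single (J ω)]
        · rw [Set.indicator_of_mem (by simp)]
        · intro s _ hs
          rw [Set.indicator_of_notMem (by simpa using hs.symm), zero_mul]
        · simp
    _ = ∑ s : Finset ι, ∫⁻ ω, Set.indicator {ω | J ω = s} F ω *
          ENNReal.ofReal (Real.exp (∑ j ∈ s, ψ j ω)) ∂P := by
        rw [lintegral_finsetSum]
        intro s _
        exact ((hFs s).mono hℱ le_rfl).mul ((hEm s).mono h𝒢 le_rfl)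
    _ = ∑ s : Finset ι, (∫⁻ ω, Set.indicator {ω | J ω = s} F ω ∂P) *
          ∫⁻ ω, ENNReal.ofReal (Real.exp (∑ j ∈ s, ψ j ω)) ∂P := by
        refine sum_congr rfl fun s _ ↦ ?_
        exact lintegral_mul_eq_lintegral_mul_lintegral_of_independent_measurableSpace
          hℱ h𝒢 hind (hFs s) (hEm s)
    _ ≤ ∑ s : Finset ι, (∫⁻ ω, Set.indicator {ω | J ω = s} F ω ∂P) := by
        refine sum_le_sum fun s _ ↦ ?_
        exact (mul_le_mul_right (hone s) _).trans (mul_one _).le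
    _ = ∫⁻ ω, F ω ∂P := by
        rw [← lintegral_finsetSum]
        · refine lintegral_congr fun ω ↦ ?_
          simp [Set.indicator_apply]
        · exact fun s _ ↦ (hFs s).mono hℱ le_rfl

open scoped Classical in
/-- A product of conditionally sub-unit exponential factors over predictable index sets has
expectation at most one. -/
theorem lintegral_exp_predictable_sum_le_one [IsProbabilityMeasure P]
    (ℱ : Filtration ℕ mΩ) (𝒢 : ℕ → MeasurableSpace Ω)
    (J : ℕ → Ω → Finset ι) (ψ : ℕ → ι → Ω → ℝ)
    (hJ : ∀ t s, MeasurableSet[ℱ t] {ω | J t ω = s})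
    (h𝒢 : ∀ t, 𝒢 t ≤ ℱ (t + 1)) (hψ : ∀ t j, Measurable[𝒢 t] (ψ t j))
    (hind : ∀ t, Indep (ℱ t) (𝒢 t) P)
    (hone : ∀ t s, ∫⁻ ω, ENNReal.ofReal (Real.exp (∑ j ∈ s, ψ t j ω)) ∂P ≤ 1) (n : ℕ) :
    Measurable[ℱ n] (fun ω ↦ ∑ t ∈ range n, ∑ j ∈ J t ω, ψ t j ω) ∧
    ∫⁻ ω, ENNReal.ofReal (Real.exp (∑ t ∈ range n, ∑ j ∈ J t ω, ψ t j ω)) ∂P ≤ 1 := by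
  induction n with
  | zero => simp
  | succ n ih =>
    obtain ⟨hm, hle⟩ := ih
    constructor
    · simp_rw [sum_range_succ]
      refine Measurable.add (hm.mono (ℱ.mono n.le_succ) le_rfl) ?_
      have : (fun ω ↦ ∑ j ∈ J n ω, ψ n j ω) = fun ω ↦ ∑ s : Finset ι,
          Set.indicator {ω | J n ω = s} (fun ω ↦ ∑ j ∈ s, ψ n j ω) ω := by
        funext ω
        simp [Set.indicator_apply]
      rw [this]
      refine Finset.measurable_fun_sum _ fun s _ ↦ ?_
      exact ((Finset.measurable_fun_sum s fun j _ ↦ hψ n j).mono (h𝒢 n) le_rfl).indicator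
        (ℱ.mono n.le_succ _ (hJ n s))
    · have hFm : Measurable[ℱ n] (fun ω ↦
          ENNReal.ofReal (Real.exp (∑ t ∈ range n, ∑ j ∈ J t ω, ψ t j ω))) :=
        ENNReal.measurable_ofReal.comp (Real.measurable_exp.comp hm)
      refine le_trans (le_of_eq (lintegral_congr fun ω ↦ ?_)) ((lintegral_mul_exp_sum_le (ℱ.le n)
        ((h𝒢 n).trans (ℱ.le _)) (hind n) hFm (hJ n) (hψ n) (hone n)).trans hle)
      rw [sum_range_succ, Real.exp_add, ENNReal.ofReal_mul (Real.exp_nonneg _)]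

/-- Exponential Markov inequality for predictable sums. -/
theorem measureReal_predictable_sum_ge_le [IsProbabilityMeasure P]
    (ℱ : Filtration ℕ mΩ) (𝒢 : ℕ → MeasurableSpace Ω)
    (J : ℕ → Ω → Finset ι) (ψ : ℕ → ι → Ω → ℝ)
    (hJ : ∀ t s, MeasurableSet[ℱ t] {ω | J t ω = s})
    (h𝒢 : ∀ t, 𝒢 t ≤ ℱ (t + 1)) (hψ : ∀ t j, Measurable[𝒢 t] (ψ t j))
    (hind : ∀ t, Indep (ℱ t) (𝒢 t) P)
    (hone : ∀ t s, ∫⁻ ω, ENNReal.ofReal (Real.exp (∑ j ∈ s, ψ t j ω)) ∂P ≤ 1) (n : ℕ) (x : ℝ) :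
    P.real {ω | x ≤ ∑ t ∈ range n, ∑ j ∈ J t ω, ψ t j ω} ≤ Real.exp (-x) := by
  obtain ⟨hm, hle⟩ := lintegral_exp_predictable_sum_le_one ℱ 𝒢 J ψ hJ h𝒢 hψ hind hone n
  have hmark := meas_ge_le_lintegral_div (μ := P) (ε := ENNReal.ofReal (Real.exp x))
    (ENNReal.measurable_ofReal.comp
      (Real.measurable_exp.comp (hm.mono (ℱ.le _) le_rfl))).aemeasurable
    (by simpa using Real.exp_pos x) ENNReal.ofReal_ne_top
  have hset : {ω | x ≤ ∑ t ∈ range n, ∑ j ∈ J t ω, ψ t j ω} =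
      {ω | ENNReal.ofReal (Real.exp x) ≤
        (ENNReal.ofReal ∘ Real.exp ∘ fun ω ↦ ∑ t ∈ range n, ∑ j ∈ J t ω, ψ t j ω) ω} := by
    ext ω
    simp [ENNReal.ofReal_le_ofReal_iff (Real.exp_nonneg _)]
  rw [← hset] at hmark
  refine ENNReal.toReal_le_of_le_ofReal (Real.exp_nonneg _) (hmark.trans ?_)
  rw [Real.exp_neg, ENNReal.ofReal_inv_of_pos (Real.exp_pos x), ← one_div]
  exact ENNReal.div_le_div_right hle _

end ExponentialSupermartingale

end MultiStar

namespace MultiStar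

open Finset

/-! ### Tail bounds for observed rewards and for received links -/

section RoundAlgebra

variable {Ω : Type u} {K N : ℕ} {X : ℕ → Fin K → Fin N → Ω → ℝ}
  {I : ℕ → Fin K → Fin K → Ω → Bool}

/-- The information of round `t + 1`: rewards and communication. -/
abbrev roundAlgebra (X : ℕ → Fin K → Fin N → Ω → ℝ) (I : ℕ → Fin K → Fin K → Ω → Bool) (t : ℕ) :
    MeasurableSpace Ω :=
  MeasurableSpace.comap
    (fun (ω : Ω) ↦ ((fun (k : Fin K) (i : Fin N) ↦ X (t + 1) k i ω),
      (fun (k j : Fin K) ↦ I (t + 1) k j ω))) inferInstance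

theorem measurable_reward_roundAlgebra (t : ℕ) (k : Fin K) (i : Fin N) :
    Measurable[roundAlgebra X I t] (X (t + 1) k i) := by
  have h : Measurable (fun q : (Fin K → Fin N → ℝ) × (Fin K → Fin K → Bool) ↦ q.1 k i) := by
    fun_prop
  exact h.comp (comap_measurable _)

theorem measurable_link_roundAlgebra (t : ℕ) (k j : Fin K) :
    Measurable[roundAlgebra X I t] (I (t + 1) k j) := by
  have h : Measurable (fun q : (Fin K → Fin N → ℝ) × (Fin K → Fin K → Bool) ↦ q.2 k j) := by
    fun_prop
  exact h.comp (comap_measurable _)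

theorem roundAlgebra_le_of_measurable {𝓜 : MeasurableSpace Ω} {t : ℕ}
    (hX : ∀ k i, Measurable (X (t + 1) k i)) (hI : ∀ k j, Measurable (I (t + 1) k j)) :
    roundAlgebra X I t ≤ 𝓜 :=
  Measurable.comap_le (Measurable.prodMk
    (measurable_pi_lambda _ fun k ↦ measurable_pi_lambda _ fun i ↦ hX k i)
    (measurable_pi_lambda _ fun k ↦ measurable_pi_lambda _ fun j ↦ hI k j))

end RoundAlgebra

section Tails

variable {Ω : Type u} {K N m : ℕ} [mΩ : MeasurableSpace Ω] {P : Measure Ω}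
  {ℱ : Filtration ℕ mΩ} {G : SimpleGraph (Fin K)} {p : ℝ} {ν : Fin N → Measure ℝ}
  {σ : Fin N → ℝ≥0}
  {X : ℕ → Fin K → Fin N → Ω → ℝ} {φ : ℕ → Fin K → Ω → Fin N}
  {I : ℕ → Fin K → Fin K → Ω → Bool}

theorem roundAlgebra_le (h : IsBroadcastBandit P ℱ G p ν X φ I) (t : ℕ) :
    roundAlgebra X I t ≤ ℱ (t + 1) :=
  roundAlgebra_le_of_measurable (h.reward_measurable t) (h.link_measurable t)

/-- The agents that choose option `i` in round `t + 1`, while the switch `S` is on. -/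
noncomputable def activeSet (φ : ℕ → Fin K → Ω → Fin N) (i : Fin N) (S : ℕ → Set Ω) (t : ℕ) (ω : Ω) :
    Finset (Fin K) :=
  open scoped Classical in univ.filter fun j ↦ ω ∈ S t ∧ φ (t + 1) j ω = i

theorem measurableSet_activeSet_eq (h : IsBroadcastBandit P ℱ G p ν X φ I) (i : Fin N)
    {S : ℕ → Set Ω} (hS : ∀ t, MeasurableSet[ℱ t] (S t)) (t : ℕ) (s : Finset (Fin K)) :
    MeasurableSet[ℱ t] {ω | activeSet φ i S t ω = s} := by
  have : {ω | activeSet φ i S t ω = s} =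
      ⋂ j, {ω | (ω ∈ S t ∧ φ (t + 1) j ω = i) ↔ j ∈ s} := by
    ext ω
    simp [activeSet, Finset.ext_iff]
  rw [this]
  refine MeasurableSet.iInter fun j ↦ ?_
  have hj : MeasurableSet[ℱ t] {ω | ω ∈ S t ∧ φ (t + 1) j ω = i} :=
    (hS t).inter (h.choice_measurable t j (measurableSet_singleton i))
  by_cases hjs : j ∈ s
  · simpa [hjs] using hj
  · simp only [hjs, iff_false]
    exact hj.compl

/-- Over a fixed set of agents this is sub-Gaussianity and independence of their rewards. Which of
these rewards agent `k` receives is random but independent of the rewards, so the random-index lemma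
applies within the round, with trivial factor `F = 1`. -/
theorem lintegral_exp_reward_sum_le_one [IsProbabilityMeasure P] (hν : IsSubgaussianBandit ν σ)
    (h : IsBroadcastBandit P ℱ G p ν X φ I) (k : Fin K) (i : Fin N) (l : ℝ) (t : ℕ)
    (s : Finset (Fin K)) :
    ∫⁻ ω, ENNReal.ofReal (Real.exp (∑ j ∈ s, if I (t + 1) k j ω = true then
      l * (X (t + 1) j i ω - meanReward ν i) - l ^ 2 * (σ i : ℝ) ^ 2 / 2 else 0)) ∂P ≤ 1 := by
  classical
  have hXm : ∀ j i, Measurable (X (t + 1) j i) := fun j i ↦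
    (h.reward_measurable t j i).mono (ℱ.le _) le_rfl
  have hIm : ∀ k j, Measurable (I (t + 1) k j) := fun k j ↦
    (h.link_measurable t k j).mono (ℱ.le _) le_rfl
  have hsub : ∀ j, HasSubgaussianMGF (fun ω ↦ X (t + 1) j i ω - meanReward ν i) (σ i ^ 2) P := by
    intro j
    have h1 := hν.subgaussian i
    rw [← h.reward_law t j i] at h1
    exact h1.of_map (hXm j i).aemeasurable
  have hindX : iIndepFun (fun j ω ↦ X (t + 1) j i ω - meanReward ν i) P :=
    (h.reward_indep t).comp (fun _ f ↦ f i - meanReward ν i)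
      (fun _ ↦ (measurable_pi_apply i).sub_const _)
  have hone : ∀ s' : Finset (Fin K), ∫⁻ ω, ENNReal.ofReal (Real.exp (∑ j ∈ s',
      (l * (X (t + 1) j i ω - meanReward ν i) - l ^ 2 * (σ i : ℝ) ^ 2 / 2))) ∂P ≤ 1 := by
    intro s'
    have hs := HasSubgaussianMGF.sum_of_iIndepFun hindX (s := s') (fun j _ ↦ hsub j)
    have hint := hs.integrable_exp_mul l
    have hmgf := hs.mgf_le l
    simp only [sum_const, nsmul_eq_mul, NNReal.coe_mul, NNReal.coe_natCast, NNReal.coe_pow]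
      at hmgf
    have heq : ∀ ω, Real.exp (∑ j ∈ s', (l * (X (t + 1) j i ω - meanReward ν i)
        - l ^ 2 * (σ i : ℝ) ^ 2 / 2)) =
        Real.exp (l * ∑ j ∈ s', (X (t + 1) j i ω - meanReward ν i)) *
          Real.exp (-(#s' * (σ i : ℝ) ^ 2 * l ^ 2 / 2)) := by
      intro ω
      rw [← Real.exp_add]
      congr 1
      rw [sum_sub_distrib, ← mul_sum, sum_const, nsmul_eq_mul]
      ring
    simp_rw [heq]
    rw [← ofReal_integral_eq_lintegral_ofReal (hint.mul_const _)
      (ae_of_all _ fun ω ↦ by positivity), integral_mul_const]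
    refine ENNReal.ofReal_le_one.2 ?_
    calc _ ≤ Real.exp (#s' * (σ i : ℝ) ^ 2 * l ^ 2 / 2) *
          Real.exp (-(#s' * (σ i : ℝ) ^ 2 * l ^ 2 / 2)) := by
          gcongr
          exact hmgf
      _ = 1 := by rw [← Real.exp_add, add_neg_cancel, Real.exp_zero]
  have hind : Indep (MeasurableSpace.comap (fun (ω : Ω) (k j : Fin K) ↦ I (t + 1) k j ω)
        inferInstance)
      (MeasurableSpace.comap (fun (ω : Ω) (k : Fin K) (i : Fin N) ↦ X (t + 1) k i ω)
        inferInstance) P := (h.reward_link_indep t).symm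
  -- The link algebra plays the role of the past and the reward algebra that of the new round.
  have key := lintegral_mul_exp_sum_le (P := P) (F := fun _ ↦ 1)
    (J := fun ω ↦ s.filter fun j ↦ I (t + 1) k j ω = true)
    (ψ := fun j ω ↦ l * (X (t + 1) j i ω - meanReward ν i) - l ^ 2 * (σ i : ℝ) ^ 2 / 2)
    (Measurable.comap_le (by fun_prop)) (Measurable.comap_le (by fun_prop)) hind
    measurable_const ?_ ?_ hone
  · simp only [Finset.sum_filter, one_mul] at key
    simpa using key
  · intro s'
    have hmeas : MeasurableSet {f : Fin K → Fin K → Bool | s.filter (fun j ↦ f k j = true) = s'} :=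
      Set.Finite.measurableSet (Set.toFinite _)
    exact hmeas.preimage (comap_measurable _)
  · intro j
    have h1 : Measurable (fun f : Fin K → Fin N → ℝ ↦
        l * (f j i - meanReward ν i) - l ^ 2 * (σ i : ℝ) ^ 2 / 2) := by fun_prop
    exact h1.comp (comap_measurable _)

/-- Tail bound for the observed centered rewards of option `i`, restricted to the rounds in which
a predictable switch is on. -/
theorem measureReal_reward_sum_ge_le [IsProbabilityMeasure P] (hν : IsSubgaussianBandit ν σ)
    (h : IsBroadcastBandit P ℱ G p ν X φ I) (k : Fin K) (i : Fin N) (l : ℝ)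
    {S : ℕ → Set Ω} (hS : ∀ t, MeasurableSet[ℱ t] (S t)) (n : ℕ) (x : ℝ) :
    P.real {ω | x ≤ ∑ t ∈ range n, ∑ j ∈ activeSet φ i S t ω, if I (t + 1) k j ω = true then
      l * (X (t + 1) j i ω - meanReward ν i) - l ^ 2 * (σ i : ℝ) ^ 2 / 2 else 0}
      ≤ Real.exp (-x) := by
  refine measureReal_predictable_sum_ge_le ℱ (roundAlgebra X I) (activeSet φ i S)
    (fun t j ω ↦ if I (t + 1) k j ω = true then
      l * (X (t + 1) j i ω - meanReward ν i) - l ^ 2 * (σ i : ℝ) ^ 2 / 2 else 0)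
    (measurableSet_activeSet_eq h i hS) (roundAlgebra_le h) (fun t j ↦ ?_)
    h.round_indep_past (lintegral_exp_reward_sum_le_one hν h k i l) n x
  refine Measurable.ite (measurable_link_roundAlgebra t k j (measurableSet_singleton true)) ?_
    measurable_const
  have := measurable_reward_roundAlgebra (X := X) (I := I) t j i
  exact ((this.sub_const _).const_mul _).sub_const _

/-- In a complete graph, the number of observations of an agent dominates the expected number of
received broadcasts, in the exponential sense. -/
theorem lintegral_exp_link_sum_le_one [IsProbabilityMeasure P] (hp1 : p ≤ 1)
    (hG : ∀ k j, k ≠ j → G.Adj k j)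
    (h : IsBroadcastBandit P ℱ G p ν X φ I) (k : Fin K) {θ : ℝ} (hθ : 0 ≤ θ) (t : ℕ)
    (s : Finset (Fin K)) :
    ∫⁻ ω, ENNReal.ofReal (Real.exp (∑ j ∈ s, (p * (1 - Real.exp (-θ)) -
      if I (t + 1) k j ω = true then θ else 0))) ∂P ≤ 1 := by
  have hIm : ∀ k j, Measurable (I (t + 1) k j) := fun k j ↦
    (h.link_measurable t k j).mono (ℱ.le _) le_rfl
  set q := p * (1 - Real.exp (-θ)) with hq
  have hq0 : 0 ≤ 1 - Real.exp (-θ) := by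
    have := Real.exp_le_one_iff.2 (neg_nonpos.2 hθ)
    linarith
  set f : Bool → ℝ := fun b ↦ q - if b = true then θ else 0 with hf
  have hfm : Measurable f := measurable_of_finite f
  have hind : iIndepFun (fun j ω ↦ f (I (t + 1) k j ω)) P :=
    (h.link_indep t k).comp (fun _ ↦ f) (fun _ ↦ hfm)
  have hint : ∀ g : Bool → ℝ, ∀ j, ∫ ω, g (I (t + 1) k j ω) ∂P =
      P.real {ω | I (t + 1) k j ω = true} * g true +
        (1 - P.real {ω | I (t + 1) k j ω = true}) * g false := by
    intro g j
    have hset : MeasurableSet {ω | I (t + 1) k j ω = true} :=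
      hIm k j (measurableSet_singleton true)
    have h1 : ∀ ω, g (I (t + 1) k j ω) = Set.indicator {ω | I (t + 1) k j ω = true}
        (fun _ ↦ g true - g false) ω + g false := by
      intro ω
      by_cases hω : I (t + 1) k j ω = true
      · simp [hω]
      · simp [hω]
    simp_rw [h1]
    rw [integral_add ((integrable_const _).indicator hset) (integrable_const _),
      integral_indicator_const _ hset]
    simp
    ring
  have hfac : ∀ j, mgf (fun ω ↦ f (I (t + 1) k j ω)) P 1 ≤ 1 := by
    intro j
    have h2 := hint (fun b ↦ Real.exp (1 * f b)) j
    rw [mgf, h2]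
    simp only [hf, one_mul, if_true, Bool.false_eq_true, if_false, sub_zero]
    -- An agent's link to itself is always on; there the factor is `exp (q - θ)`, and `q ≤ 1 - exp
    -- (-θ) ≤ θ`. For a neighbor, the mean of `exp (-θ I)` is exactly `1 - q ≤ exp (-q)`.
    by_cases hkj : k = j
    · subst hkj
      have : {ω | I (t + 1) k k ω = true} = Set.univ := by
        ext ω; simpa using h.link_self t k ω
      rw [this]
      simp only [probReal_univ, one_mul, sub_self, zero_mul, add_zero]
      rw [Real.exp_le_one_iff]
      have h3 := Real.add_one_le_exp (-θ)
      have h4 : q ≤ 1 - Real.exp (-θ) := by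
        rw [hq]; exact mul_le_of_le_one_left hq0 hp1
      linarith
    · rw [h.link_prob t k j (hG k j hkj), sub_eq_add_neg, Real.exp_add]
      have h3 : 1 - q ≤ Real.exp (-q) := by
        have := Real.add_one_le_exp (-q); linarith
      calc p * (Real.exp q * Real.exp (-θ)) + (1 + -p) * Real.exp q
          = Real.exp q * (1 - q) := by rw [hq]; ring
        _ ≤ Real.exp q * Real.exp (-q) := by gcongr
        _ = 1 := by rw [← Real.exp_add, add_neg_cancel, Real.exp_zero]
  have hsum := hind.mgf_sum (t := 1) (fun j ↦ hfm.comp (hIm k j)) s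
  have hle : mgf (∑ j ∈ s, fun ω ↦ f (I (t + 1) k j ω)) P 1 ≤ 1 := by
    rw [hsum]
    exact prod_le_one (fun j _ ↦ mgf_nonneg) fun j _ ↦ hfac j
  have hbd : Integrable (fun ω ↦ Real.exp (∑ j ∈ s, f (I (t + 1) k j ω))) P := by
    have := hind.integrable_exp_mul_sum (t := 1) (fun j ↦ hfm.comp (hIm k j)) (s := s) ?_
    · simpa using this
    · intro j _
      have hb : Measurable (fun b ↦ Real.exp (1 * f b)) := measurable_of_finite _
      refine Integrable.of_bound (hb.comp (hIm k j)).aestronglyMeasurable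
        (Real.exp (1 * f true) + Real.exp (1 * f false)) (ae_of_all _ fun ω ↦ ?_)
      rw [Real.norm_of_nonneg (Real.exp_nonneg _)]
      cases I (t + 1) k j ω
      · linarith [Real.exp_pos (1 * f true)]
      · linarith [Real.exp_pos (1 * f false)]
  have heq : ∀ ω, ∑ j ∈ s, (q - if I (t + 1) k j ω = true then θ else 0) =
    ∑ j ∈ s, f (I (t + 1) k j ω) := fun ω ↦ rfl
  simp_rw [heq]
  rw [← ofReal_integral_eq_lintegral_ofReal hbd (ae_of_all _ fun ω ↦ Real.exp_nonneg _)]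
  refine ENNReal.ofReal_le_one.2 ?_
  simpa [mgf] using hle

/-- Tail bound for the link process of a complete graph, with predictable index sets. -/
theorem measureReal_link_sum_ge_le [IsProbabilityMeasure P] (hp1 : p ≤ 1)
    (hG : ∀ k j, k ≠ j → G.Adj k j)
    (h : IsBroadcastBandit P ℱ G p ν X φ I) (k : Fin K) {θ : ℝ} (hθ : 0 ≤ θ)
    (J : ℕ → Ω → Finset (Fin K)) (hJ : ∀ t s, MeasurableSet[ℱ t] {ω | J t ω = s})
    (n : ℕ) (x : ℝ) :
    P.real {ω | x ≤ ∑ t ∈ range n, ∑ j ∈ J t ω, (p * (1 - Real.exp (-θ)) -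
      if I (t + 1) k j ω = true then θ else 0)} ≤ Real.exp (-x) := by
  refine measureReal_predictable_sum_ge_le ℱ (roundAlgebra X I) J
    (fun t j ω ↦ p * (1 - Real.exp (-θ)) - if I (t + 1) k j ω = true then θ else 0)
    hJ (roundAlgebra_le h) (fun t j ↦ ?_)
    h.round_indep_past (lintegral_exp_link_sum_le_one hp1 hG h k hθ) n x
  refine Measurable.const_sub (Measurable.ite
    (measurable_link_roundAlgebra t k j (measurableSet_singleton true))
    measurable_const measurable_const) _

end Tails

end MultiStar

namespace MultiStar

open Finset

/-! ### Pathwise identities for observation counts and centered sums -/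

section Paths

variable {Ω : Type u} {K N : ℕ}

theorem sum_Icc_one_eq_sum_range {M : Type*} [AddCommMonoid M] (f : ℕ → M) (t : ℕ) :
    ∑ τ ∈ Icc 1 t, f τ = ∑ τ ∈ range t, f (τ + 1) := by
  induction t with
  | zero => simp
  | succ t ih => rw [sum_Icc_succ_top (by omega), ih, sum_range_succ]

/-- The sum of the centered rewards of option `i` observed by agent `k` up to round `t`. -/
noncomputable def centeredSum (ν : Fin N → Measure ℝ) (X : ℕ → Fin K → Fin N → Ω → ℝ)
    (φ : ℕ → Fin K → Ω → Fin N) (I : ℕ → Fin K → Fin K → Ω → Bool) (k : Fin K) (i : Fin N)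
    (t : ℕ) (ω : Ω) : ℝ :=
  rewardSum X φ I k i t ω - meanReward ν i * numObs φ I k i t ω

theorem numObs_zero (φ : ℕ → Fin K → Ω → Fin N) (I : ℕ → Fin K → Fin K → Ω → Bool) (k : Fin K)
    (i : Fin N) (ω : Ω) : numObs φ I k i 0 ω = 0 := by
  simp [numObs]

theorem numObs_succ (φ : ℕ → Fin K → Ω → Fin N) (I : ℕ → Fin K → Fin K → Ω → Bool) (k : Fin K)
    (i : Fin N) (t : ℕ) (ω : Ω) : numObs φ I k i (t + 1) ω = numObs φ I k i t ω +
      ∑ j, if φ (t + 1) j ω = i ∧ I (t + 1) k j ω = true then 1 else 0 := by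
  simp only [numObs, sum_Icc_one_eq_sum_range, sum_range_succ]

theorem numObs_mono (φ : ℕ → Fin K → Ω → Fin N) (I : ℕ → Fin K → Fin K → Ω → Bool) (k : Fin K)
    (i : Fin N) (ω : Ω) : Monotone fun t ↦ numObs φ I k i t ω := by
  refine monotone_nat_of_le_succ fun t ↦ ?_
  rw [numObs_succ]
  exact Nat.le_add_right _ _

theorem activeSet_univ (φ : ℕ → Fin K → Ω → Fin N) (i : Fin N) (t : ℕ) (ω : Ω) :
    activeSet φ i (fun _ ↦ Set.univ) t ω = univ.filter fun j ↦ φ (t + 1) j ω = i := by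
  simp [activeSet]

theorem activeSet_of_mem (φ : ℕ → Fin K → Ω → Fin N) (i : Fin N) {S : ℕ → Set Ω} {t : ℕ} {ω : Ω}
    (h : ω ∈ S t) : activeSet φ i S t ω = univ.filter fun j ↦ φ (t + 1) j ω = i := by
  simp [activeSet, h]

theorem activeSet_of_notMem (φ : ℕ → Fin K → Ω → Fin N) (i : Fin N) {S : ℕ → Set Ω} {t : ℕ}
    {ω : Ω} (h : ω ∉ S t) : activeSet φ i S t ω = ∅ := by
  simp [activeSet, h]

theorem sum_activeSet_univ (ν : Fin N → Measure ℝ) (X : ℕ → Fin K → Fin N → Ω → ℝ)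
    (φ : ℕ → Fin K → Ω → Fin N) (I : ℕ → Fin K → Fin K → Ω → Bool) (k : Fin K) (i : Fin N)
    (l c : ℝ) (t : ℕ) (ω : Ω) :
    ∑ τ ∈ range t, ∑ j ∈ univ.filter (fun j ↦ φ (τ + 1) j ω = i),
      (if I (τ + 1) k j ω = true then l * (X (τ + 1) j i ω - meanReward ν i) - c else 0) =
      l * centeredSum ν X φ I k i t ω - c * numObs φ I k i t ω := by
  simp only [centeredSum, rewardSum, numObs, sum_Icc_one_eq_sum_range]
  push_cast
  simp only [mul_sum, mul_sub, ← sum_sub_distrib]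
  refine sum_congr rfl fun τ _ ↦ ?_
  rw [sum_filter]
  refine sum_congr rfl fun j _ ↦ ?_
  by_cases h1 : φ (τ + 1) j ω = i <;> by_cases h2 : I (τ + 1) k j ω = true <;> simp [h1, h2]

/-- Stopping the observations of option `i` once their number reaches `n` keeps the process at its
value at any time when there are exactly `n` observations. -/
theorem sum_activeSet_stopped (ν : Fin N → Measure ℝ) (X : ℕ → Fin K → Fin N → Ω → ℝ)
    (φ : ℕ → Fin K → Ω → Fin N) (I : ℕ → Fin K → Fin K → Ω → Bool) (k : Fin K) (i : Fin N)
    (l c : ℝ) {n t T : ℕ} (ht : t ≤ T) {ω : Ω} (hn : numObs φ I k i t ω = n) {S : ℕ → Set Ω}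
    (hS : ∀ τ, ω ∈ S τ ↔ numObs φ I k i τ ω < n) :
    ∑ τ ∈ range T, ∑ j ∈ activeSet φ i S τ ω,
      (if I (τ + 1) k j ω = true then l * (X (τ + 1) j i ω - meanReward ν i) - c else 0) =
      l * centeredSum ν X φ I k i t ω - c * n := by
  subst hn
  rw [← sum_activeSet_univ, ← sum_subset (range_subset_range.2 ht)]
  · refine sum_congr rfl fun τ hτ ↦ ?_
    -- In a round `τ < t` whose count has already reached its value at time `t`, nothing is
    -- observed, so switching the round off loses only zeros.
    by_cases hlt : numObs φ I k i τ ω < numObs φ I k i t ω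
    · rw [activeSet_of_mem φ i ((hS τ).2 hlt)]
    · rw [activeSet_of_notMem φ i (mt (hS τ).1 hlt), sum_empty]
      symm
      refine sum_eq_zero fun j hj ↦ ?_
      rw [if_neg]
      intro hI
      have h1 := numObs_mono φ I k i ω (Nat.succ_le_of_lt (mem_range.1 hτ))
      simp only [Nat.succ_eq_add_one, numObs_succ] at h1
      have h2 : 1 ≤ ∑ j, if φ (τ + 1) j ω = i ∧ I (τ + 1) k j ω = true then 1 else 0 := by
        refine le_trans ?_ (single_le_sum (fun _ _ ↦ Nat.zero_le _) (mem_univ j))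
        simp [(mem_filter.1 hj).2, hI]
      omega
  · intro τ _ hτ
    rw [activeSet_of_notMem, sum_empty]
    have h1 := numObs_mono φ I k i ω (not_lt.1 fun h ↦ hτ (mem_range.2 h))
    exact mt (hS τ).1 (not_lt.2 h1)

end Paths

/-! ### Deviation probabilities of the estimates -/

section Events

variable {Ω : Type u} {K N : ℕ} [mΩ : MeasurableSpace Ω] {P : Measure Ω}
  {ℱ : Filtration ℕ mΩ} {G : SimpleGraph (Fin K)} {p : ℝ} {ν : Fin N → Measure ℝ}
  {σ : Fin N → ℝ≥0}
  {X : ℕ → Fin K → Fin N → Ω → ℝ} {φ : ℕ → Fin K → Ω → Fin N}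
  {I : ℕ → Fin K → Fin K → Ω → Bool}

theorem measurable_numObs (h : IsBroadcastBandit P ℱ G p ν X φ I) (k : Fin K) (i : Fin N)
    (t : ℕ) : Measurable[ℱ t] (numObs φ I k i t) := by
  induction t with
  | zero =>
    have : numObs φ I k i 0 = fun _ ↦ 0 := funext fun ω ↦ numObs_zero φ I k i ω
    rw [this]
    exact measurable_const
  | succ t ih =>
    have : numObs φ I k i (t + 1) = fun ω ↦ numObs φ I k i t ω +
        ∑ j, if φ (t + 1) j ω = i ∧ I (t + 1) k j ω = true then 1 else 0 :=
      funext fun ω ↦ numObs_succ φ I k i t ω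
    rw [this]
    refine Measurable.add (ih.mono (ℱ.mono t.le_succ) le_rfl) ?_
    refine Finset.measurable_fun_sum _ fun j _ ↦ Measurable.ite (MeasurableSet.inter ?_ ?_)
      measurable_const measurable_const
    · exact ℱ.mono t.le_succ _ (h.choice_measurable t j (measurableSet_singleton i))
    · exact h.link_measurable t k j (measurableSet_singleton true)

theorem measurable_centeredSum (h : IsBroadcastBandit P ℱ G p ν X φ I) (k : Fin K) (i : Fin N)
    (t : ℕ) : Measurable (centeredSum ν X φ I k i t) := by
  unfold centeredSum rewardSum
  simp only [sum_Icc_one_eq_sum_range]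
  refine Measurable.sub (Finset.measurable_fun_sum _ fun τ _ ↦
    Finset.measurable_fun_sum _ fun j _ ↦ Measurable.ite (MeasurableSet.inter ?_ ?_) ?_
      measurable_const) ?_
  · exact ℱ.le _ _ (h.choice_measurable τ j (measurableSet_singleton i))
  · exact ℱ.le _ _ (h.link_measurable τ k j (measurableSet_singleton true))
  · exact (h.reward_measurable τ j i).mono (ℱ.le _) le_rfl
  · have h1 := (measurable_numObs h k i t).mono (ℱ.le _) le_rfl
    exact (measurable_from_nat (f := fun n : ℕ ↦ (n : ℝ))|>.comp h1).const_mul _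

/-- If more than `b` observations are available, the centered average exceeds `δ` with
exponentially small probability. -/
theorem measureReal_numObs_gt_centeredSum_ge_le [IsProbabilityMeasure P]
    (hν : IsSubgaussianBandit ν σ) (h : IsBroadcastBandit P ℱ G p ν X φ I) (k : Fin K)
    (i : Fin N) (t : ℕ) (b : ℝ) {δ : ℝ} (hδ : 0 ≤ δ) :
    P.real {ω | b < numObs φ I k i t ω ∧ δ * numObs φ I k i t ω ≤ centeredSum ν X φ I k i t ω} ≤
      Real.exp (-(b * (δ ^ 2 / (2 * (σ i : ℝ) ^ 2)))) := by
  have hσ : (0 : ℝ) < σ i := hν.sigma_pos i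
  -- The tilt `δ/σ²` maximizes `lδ - l²σ²/2`, with value `δ²/(2σ²)` per observation.
  refine le_trans (measureReal_mono ?_) (measureReal_reward_sum_ge_le hν h k i
    (δ / (σ i : ℝ) ^ 2) (S := fun _ ↦ Set.univ) (fun _ ↦ MeasurableSet.univ) t
    (b * (δ ^ 2 / (2 * (σ i : ℝ) ^ 2))))
  rintro ω ⟨h1, h2⟩
  simp only [Set.mem_ofPred_eq, activeSet_univ]
  rw [sum_activeSet_univ]
  calc b * (δ ^ 2 / (2 * (σ i : ℝ) ^ 2))
      ≤ numObs φ I k i t ω * (δ ^ 2 / (2 * (σ i : ℝ) ^ 2)) := by gcongr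
    _ = δ / (σ i : ℝ) ^ 2 * (δ * numObs φ I k i t ω)
        - (δ / (σ i : ℝ) ^ 2) ^ 2 * (σ i : ℝ) ^ 2 / 2 * numObs φ I k i t ω := by
        field_simp; ring
    _ ≤ _ := by gcongr

/-- The probability that the average of the first `n` observations ever exceeds `δ`. -/
theorem measureReal_exists_numObs_eq_centeredSum_ge_le [IsProbabilityMeasure P]
    (hν : IsSubgaussianBandit ν σ) (h : IsBroadcastBandit P ℱ G p ν X φ I) (k : Fin K)
    (i : Fin N) (T n : ℕ) {δ : ℝ} (hδ : 0 ≤ δ) :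
    P.real {ω | ∃ t ≤ T, numObs φ I k i t ω = n ∧ δ * n ≤ centeredSum ν X φ I k i t ω} ≤
      Real.exp (-(n * (δ ^ 2 / (2 * (σ i : ℝ) ^ 2)))) := by
  have hσ : (0 : ℝ) < σ i := hν.sigma_pos i
  -- Stopping at `n` observations makes a single supermartingale serve all times `t ≤ T`, so no
  -- union bound over `t` is paid. A round may jump past the value `n`; then the event simply does
  -- not occur.
  refine le_trans (measureReal_mono ?_) (measureReal_reward_sum_ge_le hν h k i
    (δ / (σ i : ℝ) ^ 2) (S := fun τ ↦ {ω | numObs φ I k i τ ω < n})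
    (fun τ ↦ measurable_numObs h k i τ measurableSet_Iio) T
    (n * (δ ^ 2 / (2 * (σ i : ℝ) ^ 2))))
  rintro ω ⟨t, ht, h1, h2⟩
  rw [Set.mem_ofPred_eq, sum_activeSet_stopped ν X φ I k i _ _ ht h1 fun τ ↦ Iff.rfl]
  calc n * (δ ^ 2 / (2 * (σ i : ℝ) ^ 2))
      = δ / (σ i : ℝ) ^ 2 * (δ * n)
        - (δ / (σ i : ℝ) ^ 2) ^ 2 * (σ i : ℝ) ^ 2 / 2 * n := by
        field_simp; ring
    _ ≤ _ := by gcongr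

/-- A self-normalized lower tail bound, obtained by peeling dyadically over the number of
observations. -/
theorem measureReal_centeredSum_le_neg_sqrt_le [IsProbabilityMeasure P]
    (hν : IsSubgaussianBandit ν σ) (h : IsBroadcastBandit P ℱ G p ν X φ I) (k : Fin K)
    (i : Fin N) (t Q : ℕ) {L : ℝ} (hL : 0 ≤ L) (hQ : ∀ ω, numObs φ I k i t ω < 2 ^ Q) :
    P.real {ω | 0 < numObs φ I k i t ω ∧
      centeredSum ν X φ I k i t ω ≤ -((σ i : ℝ) * √(2 * L * numObs φ I k i t ω))} ≤
      Q * Real.exp (-(3 / 4 * L)) := by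
  have hσ : (0 : ℝ) < σ i := hν.sigma_pos i
  -- On the block `2^q ≤ n < 2^(q+1)` the tilt is the one optimal at `n = 2^q`. With `w = √(n/2^q)`
  -- the exponent is at least `L(2w - w²)`.
  have hsub : {ω | 0 < numObs φ I k i t ω ∧
      centeredSum ν X φ I k i t ω ≤ -((σ i : ℝ) * √(2 * L * numObs φ I k i t ω))} ⊆
      ⋃ q ∈ range Q, {ω | 3 / 4 * L ≤ ∑ τ ∈ range t,
        ∑ j ∈ activeSet φ i (fun _ ↦ Set.univ) τ ω, if I (τ + 1) k j ω = true then
          (-(√(2 * L / 2 ^ q) / σ i)) * (X (τ + 1) j i ω - meanReward ν i)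
            - (-(√(2 * L / 2 ^ q) / σ i)) ^ 2 * (σ i : ℝ) ^ 2 / 2 else 0} := by
    rintro ω ⟨h0, h1⟩
    set n := numObs φ I k i t ω with hn
    have hq1 : 2 ^ Nat.log 2 n ≤ n := Nat.pow_log_le_self 2 h0.ne'
    have hq2 : n < 2 ^ (Nat.log 2 n + 1) := Nat.lt_pow_succ_log_self (by norm_num) n
    have hq3 : Nat.log 2 n < Q :=
      (Nat.pow_lt_pow_iff_right (by norm_num)).1 (hq1.trans_lt (hQ ω))
    refine Set.mem_biUnion (x := Nat.log 2 n) (by simpa using hq3) ?_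
    simp only [Set.mem_ofPred_eq, activeSet_univ]
    rw [sum_activeSet_univ, ← hn]
    set v : ℝ := 2 ^ Nat.log 2 n with hv
    have hv0 : 0 < v := by positivity
    have hnv : v ≤ n := by rw [hv]; exact_mod_cast hq1
    have hnv2 : (n : ℝ) ≤ 2 * v := by
      rw [hv, mul_comm, ← pow_succ]; exact_mod_cast hq2.le
    set w := √(n / v) with hw
    have hw2 : w ^ 2 = n / v := Real.sq_sqrt (by positivity)
    have hw1 : 1 ≤ w := by
      rw [hw]; exact Real.one_le_sqrt.2 ((one_le_div hv0).2 hnv)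
    have hw3 : w ≤ 3 / 2 := by
      refine Real.sqrt_le_iff.2 ⟨by norm_num, ?_⟩
      rw [div_le_iff₀ hv0]; linarith
    have hprod : √(2 * L / v) * √(2 * L * n) = 2 * L * w := by
      rw [hw, ← Real.sqrt_mul (by positivity), show 2 * L / v * (2 * L * n) =
        (2 * L) ^ 2 * (n / v) by ring, Real.sqrt_mul (by positivity), Real.sqrt_sq (by positivity)]
    have hsq : (-(√(2 * L / v) / σ i)) ^ 2 * (σ i : ℝ) ^ 2 / 2 * n = L * w ^ 2 := by
      rw [neg_sq, div_pow, Real.sq_sqrt (by positivity), hw2]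
      field_simp
    rw [hsq]
    have h3 : 2 * L * w ≤ -(√(2 * L / v) / σ i) * centeredSum ν X φ I k i t ω := by
      calc 2 * L * w = √(2 * L / v) / σ i * (σ i * √(2 * L * n)) := by
            rw [← hprod]; field_simp
        _ ≤ √(2 * L / v) / σ i * (-centeredSum ν X φ I k i t ω) := by
            gcongr; linarith
        _ = _ := by ring
    -- Indeed `2w - w² = 1 - (w - 1)²` and `1 ≤ w ≤ 3/2`.
    have h4 : 3 / 4 ≤ 2 * w - w ^ 2 := by nlinarith
    nlinarith [mul_le_mul_of_nonneg_left h4 hL]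
  refine (measureReal_mono hsub (measure_ne_top _ _)).trans ((measureReal_biUnion_finset_le _ _).trans ?_)
  refine (sum_le_sum fun q _ ↦ measureReal_reward_sum_ge_le hν h k i _
    (S := fun _ ↦ Set.univ) (fun _ ↦ MeasurableSet.univ) t (3 / 4 * L)).trans ?_
  simp

end Events

end MultiStar

namespace MultiStar

open Finset

/-! ### Why suboptimal options are chosen, and how often -/

section Choices

variable {Ω : Type u} {K N : ℕ} {ν : Fin N → Measure ℝ} {σ : Fin N → ℝ≥0} {α : Fin K → ℝ} {ξ : ℝ}
  {X : ℕ → Fin K → Fin N → Ω → ℝ} {φ : ℕ → Fin K → Ω → Fin N}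
  {I : ℕ → Fin K → Fin K → Ω → Bool}

/-- The threshold for the number of observations beyond which option `i` is only chosen because
of a bad estimate. -/
noncomputable def threshold (a u ξ : ℝ) (T : ℕ) : ℝ := 2 * a ^ 2 * u * (ξ + 1) * Real.log T

theorem threshold_nonneg {a u : ℝ} (hu : 0 ≤ u) (hξ : 1 < ξ) (T : ℕ) : 0 ≤ threshold a u ξ T := by
  have := Real.log_natCast_nonneg T
  unfold threshold
  positivity

/-- The outcomes for which the objective of option `i` after round `t` is below its mean, with
at least one observation. -/
def underestimated (ν : Fin N → Measure ℝ) (σ : Fin N → ℝ≥0) (ξ : ℝ)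
    (X : ℕ → Fin K → Fin N → Ω → ℝ) (φ : ℕ → Fin K → Ω → Fin N)
    (I : ℕ → Fin K → Fin K → Ω → Bool) (k : Fin K) (i : Fin N) (t : ℕ) : Set Ω :=
  {ω | 0 < numObs φ I k i t ω ∧ centeredSum ν X φ I k i t ω ≤
    -((σ i : ℝ) * √(2 * ((ξ + 1) * Real.log t) * numObs φ I k i t ω))}

/-- The outcomes for which option `i` is overestimated by `δ` after round `t`, despite more than
`b` observations. -/
def overestimated (ν : Fin N → Measure ℝ)
    (X : ℕ → Fin K → Fin N → Ω → ℝ) (φ : ℕ → Fin K → Ω → Fin N)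
    (I : ℕ → Fin K → Fin K → Ω → Bool) (b δ : ℝ) (k : Fin K) (i : Fin N) (t : ℕ) : Set Ω :=
  {ω | b < numObs φ I k i t ω ∧ δ * numObs φ I k i t ω ≤ centeredSum ν X φ I k i t ω}

/-- A suboptimal choice is due to few observations, to the underestimation of a better option, or
to the overestimation of the chosen one. -/
theorem choice_trichotomy (hU : FollowsUCB σ α ξ X φ I) {k : Fin K} (hα : 0 ≤ α k) (hξ : 1 < ξ)
    {i j : Fin N} (hσ : 0 < σ i) {D : ℝ} (hD : 0 < D)
    (hij : meanReward ν j = meanReward ν i + D) {a : ℝ} (ha : 1 < a) {t T : ℕ} (ht : 1 ≤ t)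
    (htT : t ≤ T) {ω : Ω} (hφ : φ (t + 1) k ω = i) :
    (numObs φ I k i t ω : ℝ) ≤
        (1 + α k) * threshold a ((σ i : ℝ) ^ 2 / D ^ 2) ξ T ∨
      ω ∈ underestimated ν σ ξ X φ I k j t ∨
      ω ∈ overestimated ν X φ I
        ((1 + α k) * threshold a ((σ i : ℝ) ^ 2 / D ^ 2) ξ T)
        (D * (1 - 1 / a)) k i t := by
  have hσ' : (0 : ℝ) < σ i := hσ
  have ht' : (1 : ℝ) ≤ t := by exact_mod_cast ht
  have hlog0 : 0 ≤ Real.log t := Real.log_nonneg ht'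
  have hlog : Real.log t ≤ Real.log T := Real.log_le_log (by positivity) (by exact_mod_cast htT)
  set η := (1 + α k) * threshold a ((σ i : ℝ) ^ 2 / D ^ 2) ξ T with hη
  have hη0 : 0 ≤ η := mul_nonneg (by linarith) (threshold_nonneg (by positivity) hξ T)
  rcases le_or_gt (numObs φ I k i t ω : ℝ) η with h1 | h1
  · exact Or.inl h1
  right
  have hni : (0 : ℝ) < numObs φ I k i t ω := hη0.trans_lt h1
  have hni' : numObs φ I k i t ω ≠ 0 := by
    intro h; rw [h] at hni; simp at hni
  have hobj := hU t k ω j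
  rw [hφ] at hobj
  unfold objective at hobj
  rw [if_neg hni'] at hobj
  by_cases hnj : numObs φ I k j t ω = 0
  · rw [if_pos hnj, top_le_iff] at hobj
    exact absurd hobj (EReal.coe_ne_top _)
  rw [if_neg hnj, EReal.coe_le_coe_iff] at hobj
  have hnj' : (0 : ℝ) < numObs φ I k j t ω := by
    exact_mod_cast Nat.pos_of_ne_zero hnj
  rcases lt_or_ge (estimate X φ I k j t ω + uncertainty σ α ξ φ I k j t ω) (meanReward ν j)
    with h2 | h2
  · left
    refine ⟨Nat.pos_of_ne_zero hnj, ?_⟩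
    set n : ℝ := (numObs φ I k j t ω : ℝ) with hn
    have hdev : centeredSum ν X φ I k j t ω =
        n * (estimate X φ I k j t ω - meanReward ν j) := by
      rw [centeredSum, estimate, ← hn]; field_simp
    have hunc : (σ j : ℝ) * √(2 * ((ξ + 1) * Real.log t) * n) ≤
        n * uncertainty σ α ξ φ I k j t ω := by
      rw [uncertainty, ← hn, mul_left_comm n]
      refine mul_le_mul_of_nonneg_left ?_ (NNReal.coe_nonneg _)
      rw [Real.sqrt_le_left (by positivity), mul_pow, Real.sq_sqrt (by positivity)]
      have : n ^ 2 * (2 * (1 + α k) * (ξ + 1) * Real.log t / n) =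
          (1 + α k) * (2 * ((ξ + 1) * Real.log t) * n) := by field_simp
      rw [this]
      -- The bias only widens the confidence radius, so `1 + α k ≥ 1` may be dropped for the better
      -- option.
      exact le_mul_of_one_le_left (by positivity) (by linarith)
    rw [hdev]
    nlinarith
  · right
    refine ⟨h1, ?_⟩
    set n : ℝ := (numObs φ I k i t ω : ℝ) with hn
    have hdev : centeredSum ν X φ I k i t ω =
        n * (estimate X φ I k i t ω - meanReward ν i) := by
      rw [centeredSum, estimate, ← hn]; field_simp
    -- The threshold is the sample size at which the radius with `log T` equals `D/a`; the rest of
    -- the gap, `D - D/a`, must then be an estimation error.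
    have hunc : uncertainty σ α ξ φ I k i t ω ≤ D / a := by
      rw [uncertainty, ← hn, ← le_div_iff₀' hσ', Real.sqrt_le_left (by positivity),
        div_le_iff₀ hni]
      calc 2 * (1 + α k) * (ξ + 1) * Real.log t ≤ 2 * (1 + α k) * (ξ + 1) * Real.log T := by
            gcongr
        _ = (D / a / σ i) ^ 2 * η := by rw [hη, threshold]; field_simp
        _ ≤ _ := by gcongr
    rw [hdev, mul_comm]
    refine mul_le_mul_of_nonneg_left ?_ hni.le
    have : D * (1 - 1 / a) = D - D / a := by ring
    linarith

theorem numChoices_eq (k : Fin K) (i : Fin N) (T : ℕ) (ω : Ω) :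
    (numChoices φ k i T ω : ℝ) = ∑ t ∈ range T, if φ (t + 1) k ω = i then 1 else 0 := by
  rw [numChoices, sum_Icc_one_eq_sum_range]
  push_cast
  rfl

theorem numChoices_le (k : Fin K) (i : Fin N) (T : ℕ) (ω : Ω) : numChoices φ k i T ω ≤ T := by
  rw [numChoices, sum_Icc_one_eq_sum_range]
  calc _ ≤ ∑ t ∈ range T, 1 := sum_le_sum fun t _ ↦ by split_ifs <;> simp
    _ = T := by simp

/-- Every choice of an option is also an observation of it. -/
theorem numObs_add_one_le (hI : ∀ t k ω, I (t + 1) k k ω = true) {k : Fin K} {i : Fin N} {t : ℕ}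
    {ω : Ω} (hφ : φ (t + 1) k ω = i) : numObs φ I k i t ω + 1 ≤ numObs φ I k i (t + 1) ω := by
  rw [numObs_succ]
  have : 1 ≤ ∑ j, if φ (t + 1) j ω = i ∧ I (t + 1) k j ω = true then 1 else 0 := by
    refine le_trans ?_ (single_le_sum (fun _ _ ↦ Nat.zero_le _) (mem_univ k))
    simp [hφ, hI]
  omega

/-- Each counted choice adds an own observation. Before the last one there are at most `η`
observations, hence at most `η` earlier counted choices. -/
theorem sum_choice_numObs_le (hI : ∀ t k ω, I (t + 1) k k ω = true) (k : Fin K) (i : Fin N)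
    (η : ℝ) (hη : 0 ≤ η) (T : ℕ) (ω : Ω) :
    ∑ t ∈ range T, (if φ (t + 1) k ω = i ∧ (numObs φ I k i t ω : ℝ) ≤ η then (1 : ℝ) else 0) ≤
      min (numObs φ I k i T ω : ℝ) (η + 1) := by
  induction T with
  | zero => simp [numObs_zero]; linarith
  | succ T ih =>
    rw [sum_range_succ]
    have hmono : (numObs φ I k i T ω : ℝ) ≤ numObs φ I k i (T + 1) ω := by
      exact_mod_cast numObs_mono φ I k i ω T.le_succ
    split_ifs with h
    · have h1 : (numObs φ I k i T ω : ℝ) + 1 ≤ numObs φ I k i (T + 1) ω := by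
        exact_mod_cast numObs_add_one_le hI h.1
      have h2 := ih.trans (min_le_left _ _)
      exact le_min (by linarith) (by linarith [h.2])
    · rw [add_zero]
      exact ih.trans (min_le_min_right _ hmono)

/-- The number of rounds in which an option is chosen while overestimated is at most the number of
sample sizes at which it is ever overestimated. -/
theorem sum_choice_overestimated_le (hI : ∀ t k ω, I (t + 1) k k ω = true) (k : Fin K) (i : Fin N)
    {b δ : ℝ} (hb : 0 ≤ b) {T M : ℕ} {ω : Ω} (hM : ∀ t ≤ T, numObs φ I k i t ω ≤ M) :
    ∑ t ∈ Ico 1 T, (if φ (t + 1) k ω = i then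
        (overestimated ν X φ I b δ k i t).indicator (fun _ ↦ (1 : ℝ)) ω else 0) ≤
      ∑ n ∈ Icc 1 M, Set.indicator {ω | ∃ t ≤ T, numObs φ I k i t ω = n ∧
        δ * n ≤ centeredSum ν X φ I k i t ω} (fun _ ↦ (1 : ℝ)) ω := by
  classical
  set s := (Ico 1 T).filter fun t ↦ φ (t + 1) k ω = i ∧ ω ∈ overestimated ν X φ I b δ k i t
  set s' := (Icc 1 M).filter fun n ↦ ω ∈ {ω | ∃ t ≤ T, numObs φ I k i t ω = n ∧
        δ * n ≤ centeredSum ν X φ I k i t ω}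
  have h1 : ∑ t ∈ Ico 1 T, (if φ (t + 1) k ω = i then
      (overestimated ν X φ I b δ k i t).indicator (fun _ ↦ (1 : ℝ)) ω else 0) = #s := by
    rw [card_filter]
    push_cast
    refine sum_congr rfl fun t _ ↦ ?_
    by_cases h1 : φ (t + 1) k ω = i <;> simp [h1, Set.indicator_apply]
  have h2 : ∑ n ∈ Icc 1 M, Set.indicator {ω | ∃ t ≤ T, numObs φ I k i t ω = n ∧
        δ * n ≤ centeredSum ν X φ I k i t ω} (fun _ ↦ (1 : ℝ)) ω = #s' := by
    rw [card_filter]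
    push_cast
    exact sum_congr rfl fun t _ ↦ by simp [Set.indicator_apply]
  rw [h1, h2]
  norm_cast
  -- Choosing `i` strictly increases the own count of `i`, so distinct choosing rounds have distinct
  -- sample sizes.
  refine card_le_card_of_injOn (fun t ↦ numObs φ I k i t ω) ?_ ?_
  · intro t ht
    obtain ⟨h3, h4, h5, h6⟩ := mem_filter.1 ht
    have h7 := (mem_Ico.1 h3).2.le
    refine mem_filter.2 ⟨mem_Icc.2 ⟨?_, hM t h7⟩, t, h7, rfl, h6⟩
    have : (0 : ℝ) < numObs φ I k i t ω := hb.trans_lt h5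
    exact_mod_cast this
  · have hlt : ∀ t ∈ s, ∀ t' ∈ s, t < t' → numObs φ I k i t ω < numObs φ I k i t' ω := by
      intro t ht t' _ htt'
      have h3 := numObs_add_one_le hI (mem_filter.1 ht).2.1
      have h4 := numObs_mono φ I k i ω (Nat.succ_le_of_lt htt')
      simp only [Nat.succ_eq_add_one] at h4
      omega
    intro t ht t' ht' heq
    rcases lt_trichotomy t t' with h | h | h
    · exact absurd heq (hlt t ht t' ht' h).ne
    · exact h
    · exact absurd heq (hlt t' ht' t ht h).ne'

theorem numObs_le_mul (G : SimpleGraph (Fin K)) [DecidableRel G.Adj]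
    (hG : ∀ t k j ω, k ≠ j → ¬ G.Adj k j → I (t + 1) k j ω = false) (k : Fin K) (i : Fin N)
    (t : ℕ) (ω : Ω) : numObs φ I k i t ω ≤ (1 + G.degree k) * t := by
  induction t with
  | zero => simp [numObs_zero]
  | succ t ih =>
    rw [numObs_succ, mul_add_one]
    refine add_le_add ih ?_
    rw [← card_filter]
    calc _ ≤ #(insert k (G.neighborFinset k)) := by
          refine card_le_card fun j hj ↦ ?_
          rw [mem_insert, SimpleGraph.mem_neighborFinset]
          by_contra! hcon
          have := hG t k j ω (Ne.symm hcon.1) hcon.2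
          simp [this] at hj
      _ ≤ _ := by
          refine (card_insert_le _ _).trans ?_
          rw [G.card_neighborFinset_eq_degree]; omega

/-- Summation of `choice_trichotomy` over rounds. The first choice is made without observations and
goes to the first sum, so the error events start at `t = 1`. The overestimation sum keeps its choice
indicator, which allows counting by sample size. -/
theorem numChoices_le_add (hU : FollowsUCB σ α ξ X φ I) {k : Fin K} (hα : 0 ≤ α k) (hξ : 1 < ξ)
    {i j : Fin N} (hσ : 0 < σ i) {D : ℝ} (hD : 0 < D)
    (hij : meanReward ν j = meanReward ν i + D) {a : ℝ} (ha : 1 < a) (T : ℕ) (ω : Ω) :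
    (numChoices φ k i T ω : ℝ) ≤
      ∑ t ∈ range T, (if φ (t + 1) k ω = i ∧ (numObs φ I k i t ω : ℝ) ≤
        (1 + α k) * threshold a ((σ i : ℝ) ^ 2 / D ^ 2) ξ T then (1 : ℝ) else 0) +
      ∑ t ∈ Ico 1 T, (underestimated ν σ ξ X φ I k j t).indicator (fun _ ↦ (1 : ℝ)) ω +
      ∑ t ∈ Ico 1 T, (if φ (t + 1) k ω = i then
        (overestimated ν X φ I ((1 + α k) * threshold a ((σ i : ℝ) ^ 2 / D ^ 2) ξ T)
          (D * (1 - 1 / a)) k i t).indicator (fun _ ↦ (1 : ℝ)) ω else 0) := by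
  rcases Nat.eq_zero_or_pos T with rfl | hT
  · simp [numChoices]
  have hη := mul_nonneg (add_nonneg zero_le_one hα)
    (threshold_nonneg (a := a) (u := (σ i : ℝ) ^ 2 / D ^ 2) (by positivity) hξ T)
  rw [numChoices_eq, range_eq_Ico, sum_eq_sum_Ico_succ_bot hT, sum_eq_sum_Ico_succ_bot hT,
    zero_add, numObs_zero, add_assoc, add_assoc, ← sum_add_distrib, ← sum_add_distrib]
  refine add_le_add (by simp [hη]) (sum_le_sum fun t ht ↦ ?_)
  have hO : 0 ≤ (underestimated ν σ ξ X φ I k j t).indicator (fun _ ↦ (1 : ℝ)) ω :=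
    Set.indicator_nonneg (fun _ _ ↦ zero_le_one) _
  have hE : 0 ≤ (overestimated ν X φ I ((1 + α k) * threshold a ((σ i : ℝ) ^ 2 / D ^ 2) ξ T)
      (D * (1 - 1 / a)) k i t).indicator (fun _ ↦ (1 : ℝ)) ω :=
    Set.indicator_nonneg (fun _ _ ↦ zero_le_one) _
  by_cases hφ : φ (t + 1) k ω = i
  · have key := choice_trichotomy (ν := ν) hU hα hξ hσ hD hij ha (mem_Ico.1 ht).1
      (mem_Ico.1 ht).2.le hφ
    simp only [hφ, true_and, if_true]
    rcases key with h1 | h1 | h1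
    · rw [if_pos h1]; linarith
    · rw [Set.indicator_of_mem h1]
      split_ifs <;> linarith
    · have h2 := Set.indicator_of_mem (f := fun _ : Ω ↦ (1 : ℝ)) h1
      rw [h2]
      split_ifs <;> linarith
  · simp only [hφ, false_and, if_false]
    linarith

end Choices

/-! ### The cost of underestimation -/

section Underestimation

/-- The number of dyadic blocks is logarithmic in `(1 + d)t`. Giving up `t^(1/4)` absorbs `log t ≤ 4
t^(1/4)`, while `log (1 + d) ≥ 2/3` absorbs the additive constants; what remains is summable in `t`
and linear in `log (1 + d)`. -/
theorem natLog_two_add_one_mul_rpow_le {d t : ℕ} (hd : 1 ≤ d) (ht : 1 ≤ t) :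
    ((Nat.log 2 ((1 + d) * t) + 1 : ℕ) : ℝ) * (t : ℝ) ^ (-(3 / 2) : ℝ) ≤
      12 * Real.log (1 + d) * (t : ℝ) ^ (-(5 / 4) : ℝ) := by
  have ht' : (1 : ℝ) ≤ t := by exact_mod_cast ht
  have ht0 : (0 : ℝ) < t := by linarith
  have hd' : (1 : ℝ) ≤ d := by exact_mod_cast hd
  have hl2 : 2 / 3 < Real.log 2 := by linarith [Real.log_two_gt_d9]
  have hld : Real.log 2 ≤ Real.log (1 + d) := Real.log_le_log (by norm_num) (by linarith)
  have hlog : (Nat.log 2 ((1 + d) * t) : ℝ) ≤ (Real.log (1 + d) + Real.log t) * (3 / 2) := by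
    have h1 : ((2 : ℝ) ^ Nat.log 2 ((1 + d) * t)) ≤ (1 + d) * t := by
      exact_mod_cast Nat.pow_log_le_self 2 (by positivity)
    have h2 := Real.log_le_log (by positivity) h1
    rw [Real.log_pow, Real.log_mul (by positivity) (by positivity)] at h2
    have h3 : (0 : ℝ) ≤ Nat.log 2 ((1 + d) * t) := by positivity
    nlinarith
  have hlt : Real.log t ≤ 4 * (t : ℝ) ^ (1 / 4 : ℝ) := by
    have := Real.log_le_rpow_div ht0.le (show (0 : ℝ) < 1 / 4 by norm_num)
    linarith
  have hr1 : 1 ≤ (t : ℝ) ^ (1 / 4 : ℝ) := Real.one_le_rpow ht' (by norm_num)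
  have hsplit : (t : ℝ) ^ (-(5 / 4) : ℝ) = (t : ℝ) ^ (1 / 4 : ℝ) * (t : ℝ) ^ (-(3 / 2) : ℝ) := by
    rw [← Real.rpow_add ht0]; norm_num
  rw [hsplit, ← mul_assoc]
  refine mul_le_mul_of_nonneg_right ?_ (by positivity)
  push_cast
  nlinarith

variable {Ω : Type u} {K N : ℕ} [mΩ : MeasurableSpace Ω] {P : Measure Ω}
  {ℱ : Filtration ℕ mΩ} {G : SimpleGraph (Fin K)} [DecidableRel G.Adj] {p ξ : ℝ}
  {ν : Fin N → Measure ℝ} {σ : Fin N → ℝ≥0}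
  {X : ℕ → Fin K → Fin N → Ω → ℝ} {φ : ℕ → Fin K → Ω → Fin N}
  {I : ℕ → Fin K → Fin K → Ω → Bool}

theorem sum_measureReal_underestimated_le [IsProbabilityMeasure P]
    (hν : IsSubgaussianBandit ν σ) (h : IsBroadcastBandit P ℱ G p ν X φ I) (hξ : 1 < ξ)
    (k : Fin K) (hk : 1 ≤ G.degree k) (i : Fin N) (T : ℕ) :
    ∑ t ∈ Ico 1 T, P.real (underestimated ν σ ξ X φ I k i t) ≤
      12 * (∑' t : ℕ, (t : ℝ) ^ (-(5 / 4) : ℝ)) * Real.log (1 + G.degree k) := by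
  have hlog0 : 0 ≤ Real.log (1 + G.degree k) := Real.log_nonneg (by simp)
  have hs : Summable fun t : ℕ ↦ (t : ℝ) ^ (-(5 / 4) : ℝ) :=
    Real.summable_nat_rpow.2 (by norm_num)
  calc ∑ t ∈ Ico 1 T, P.real (underestimated ν σ ξ X φ I k i t)
      ≤ ∑ t ∈ Ico 1 T, 12 * Real.log (1 + G.degree k) * (t : ℝ) ^ (-(5 / 4) : ℝ) := by
        refine sum_le_sum fun t ht ↦ ?_
        have ht1 := (mem_Ico.1 ht).1
        have ht' : (1 : ℝ) ≤ t := by exact_mod_cast ht1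
        have hlt := Real.log_nonneg ht'
        refine le_trans (measureReal_centeredSum_le_neg_sqrt_le hν h k i t
          (Nat.log 2 ((1 + G.degree k) * t) + 1) (L := (ξ + 1) * Real.log t) (by positivity)
          fun ω ↦ (numObs_le_mul G h.link_nonadj k i t ω).trans_lt
            (Nat.lt_pow_succ_log_self (by norm_num) _)) ?_
        refine le_trans (mul_le_mul_of_nonneg_left ?_ (Nat.cast_nonneg _))
          (natLog_two_add_one_mul_rpow_le hk ht1)
        rw [Real.rpow_def_of_pos (by linarith)]
        refine Real.exp_le_exp.2 ?_
        -- Since `ξ + 1 > 2`, the exponent `3/4 · (ξ + 1)` is at least `3/2`.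
        nlinarith
    _ = 12 * Real.log (1 + G.degree k) * ∑ t ∈ Ico 1 T, (t : ℝ) ^ (-(5 / 4) : ℝ) := by
        rw [mul_sum]
    _ ≤ 12 * Real.log (1 + G.degree k) * ∑' t : ℕ, (t : ℝ) ^ (-(5 / 4) : ℝ) := by
        gcongr
        exact hs.sum_le_tsum _ fun t _ ↦ by positivity
    _ = _ := by ring

end Underestimation

end MultiStar

namespace MultiStar

open Finset

/-! ### Truncated sums -/

section PredictableCounts

/-- Truncating a sum of bounded increments when the partial sums exceed `x`. -/
theorem sum_truncated_le {z : ℕ → ℝ} {c x : ℝ} (hz : ∀ s, 0 ≤ z s) (hzc : ∀ s, z s ≤ c)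
    (hx : 0 ≤ x) (T : ℕ) :
    ∑ t ∈ range T, (if ∑ s ∈ range t, z s ≤ x then z t else 0) ≤
      min (∑ s ∈ range T, z s) (x + c) := by
  induction T with
  | zero => simpa using add_nonneg hx ((hz 0).trans (hzc 0))
  | succ T ih =>
    rw [sum_range_succ, sum_range_succ]
    split_ifs with h
    · have h2 := ih.trans (min_le_left _ _)
      exact le_min (by linarith) (by linarith [hzc T])
    · rw [add_zero]
      exact ih.trans (min_le_min_right _ (by linarith [hz T]))

/-- The increment that crosses the level `x` is still kept, because truncation looks only at the
preceding partial sum. -/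
theorem lt_sum_truncated {z : ℕ → ℝ} {x : ℝ} (hx : 0 ≤ x) {t : ℕ}
    (ht : x < ∑ s ∈ range t, z s) (hz : ∀ s, 0 ≤ z s) :
    x < ∑ s ∈ range t, (if ∑ r ∈ range s, z r ≤ x then z s else 0) := by
  induction t with
  | zero => simp at ht; linarith
  | succ t ih =>
    rcases le_or_gt (∑ s ∈ range t, z s) x with h | h
    · have : ∑ s ∈ range (t + 1), (if ∑ r ∈ range s, z r ≤ x then z s else 0) =
          ∑ s ∈ range (t + 1), z s := by
        refine sum_congr rfl fun s hs ↦ if_pos (le_trans ?_ h)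
        exact sum_le_sum_of_subset_of_nonneg
          (range_subset_range.2 (Nat.lt_succ_iff.1 (mem_range.1 hs))) fun _ _ _ ↦ hz _
      rwa [this]
    · rw [sum_range_succ, if_neg (not_le.2 h), add_zero]
      exact ih h

end PredictableCounts

/-! ### Expected choices of a single agent -/

section Expectations

variable {Ω : Type u} {K N : ℕ} [mΩ : MeasurableSpace Ω] {P : Measure Ω}
  {ℱ : Filtration ℕ mΩ} {G : SimpleGraph (Fin K)} {p ξ : ℝ}
  {ν : Fin N → Measure ℝ} {σ : Fin N → ℝ≥0} {α : Fin K → ℝ}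
  {X : ℕ → Fin K → Fin N → Ω → ℝ} {φ : ℕ → Fin K → Ω → Fin N}
  {I : ℕ → Fin K → Fin K → Ω → Bool}

theorem measurableSet_underestimated (h : IsBroadcastBandit P ℱ G p ν X φ I) (k : Fin K)
    (i : Fin N) (t : ℕ) : MeasurableSet (underestimated ν σ ξ X φ I k i t) := by
  have h1 : Measurable (numObs φ I k i t) := (measurable_numObs h k i t).mono (ℱ.le _) le_rfl
  have h2 : Measurable (fun n : ℕ ↦ -((σ i : ℝ) * √(2 * ((ξ + 1) * Real.log t) * n))) :=
    measurable_from_nat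
  exact (measurableSet_lt measurable_const h1).inter
    (measurableSet_le (measurable_centeredSum h k i t) (h2.comp h1))

theorem measurableSet_overestimated (h : IsBroadcastBandit P ℱ G p ν X φ I) (b δ : ℝ) (k : Fin K)
    (i : Fin N) (t : ℕ) : MeasurableSet (overestimated ν X φ I b δ k i t) := by
  have h1 : Measurable (numObs φ I k i t) := (measurable_numObs h k i t).mono (ℱ.le _) le_rfl
  have h2 : Measurable (fun n : ℕ ↦ (n : ℝ)) := measurable_from_nat
  have h3 : Measurable (fun n : ℕ ↦ δ * (n : ℝ)) := measurable_from_nat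
  exact (measurableSet_lt measurable_const (h2.comp h1)).inter
    (measurableSet_le (h3.comp h1) (measurable_centeredSum h k i t))

theorem measurableSet_exists_numObs_eq (h : IsBroadcastBandit P ℱ G p ν X φ I) (δ : ℝ)
    (k : Fin K) (i : Fin N) (T n : ℕ) :
    MeasurableSet {ω | ∃ t ≤ T, numObs φ I k i t ω = n ∧
      δ * n ≤ centeredSum ν X φ I k i t ω} := by
  have : {ω | ∃ t ≤ T, numObs φ I k i t ω = n ∧ δ * n ≤ centeredSum ν X φ I k i t ω} =
      ⋃ t ∈ Set.Iic T, {ω | numObs φ I k i t ω = n ∧ δ * n ≤ centeredSum ν X φ I k i t ω} := by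
    ext ω; simp only [Set.mem_ofPred_eq, Set.mem_iUnion, Set.mem_Iic, exists_prop]
  rw [this]
  refine MeasurableSet.biUnion (Set.to_countable _) fun t _ ↦ ?_
  exact ((measurable_numObs h k i t).mono (ℱ.le _) le_rfl (measurableSet_singleton n)).inter
    (measurableSet_le measurable_const (measurable_centeredSum h k i t))

theorem integrable_numChoices [IsProbabilityMeasure P] (h : IsBroadcastBandit P ℱ G p ν X φ I)
    (k : Fin K) (i : Fin N) (T : ℕ) : Integrable (fun ω ↦ (numChoices φ k i T ω : ℝ)) P := by
  refine Integrable.of_bound (C := T) ?_ (ae_of_all _ fun ω ↦ ?_)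
  · simp_rw [numChoices_eq]
    refine (Finset.measurable_fun_sum _ fun t _ ↦
      Measurable.ite ?_ measurable_const measurable_const).aestronglyMeasurable
    exact ℱ.le _ _ (h.choice_measurable t k (measurableSet_singleton i))
  · rw [Real.norm_of_nonneg (Nat.cast_nonneg _)]
    exact_mod_cast numChoices_le k i T ω

theorem integral_numChoices_le_horizon [IsProbabilityMeasure P] (k : Fin K) (i : Fin N) (T : ℕ) :
    ∫ ω, (numChoices φ k i T ω : ℝ) ∂P ≤ T := by
  refine (integral_mono_of_nonneg (ae_of_all _ fun ω ↦ Nat.cast_nonneg _)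
    (integrable_const (T : ℝ)) (ae_of_all _ fun ω ↦ ?_)).trans (by simp)
  exact Nat.cast_le.2 (numChoices_le k i T ω)

variable [DecidableRel G.Adj]

/-- Expected number of choices of a suboptimal option by one agent, using only its own samples. -/
theorem integral_numChoices_le [IsProbabilityMeasure P]
    (hν : IsSubgaussianBandit ν σ) (h : IsBroadcastBandit P ℱ G p ν X φ I)
    (hU : FollowsUCB σ α ξ X φ I) {k : Fin K} (hα : 0 ≤ α k) (hξ : 1 < ξ)
    {i j : Fin N} {D : ℝ} (hD : 0 < D)
    (hij : meanReward ν j = meanReward ν i + D) {a : ℝ} (ha : 1 < a)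
    (hk : 1 ≤ G.degree k) (T : ℕ) :
    ∫ ω, (numChoices φ k i T ω : ℝ) ∂P ≤
      ((1 + α k) * threshold a ((σ i : ℝ) ^ 2 / D ^ 2) ξ T + 1) +
      12 * (∑' t : ℕ, (t : ℝ) ^ (-(5 / 4) : ℝ)) * Real.log (1 + G.degree k) +
      2 * a ^ 2 / (a - 1) ^ 2 * ((σ i : ℝ) ^ 2 / D ^ 2) := by
  have hσ := hν.sigma_pos i
  have hσ' : (0 : ℝ) < σ i := hσ
  set δ := D * (1 - 1 / a) with hδ
  have ha0 : 0 < 1 - 1 / a := by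
    rw [sub_pos, div_lt_one (by linarith)]; exact ha
  have hδ0 : 0 < δ := mul_pos hD ha0
  set η := (1 + α k) * threshold a ((σ i : ℝ) ^ 2 / D ^ 2) ξ T with hη
  have hη0 : 0 ≤ η := mul_nonneg (add_nonneg zero_le_one hα)
    (threshold_nonneg (by positivity) hξ T)
  set M := (1 + G.degree k) * T
  set E : ℕ → Set Ω := fun n ↦ {ω | ∃ t ≤ T, numObs φ I k i t ω = n ∧
        δ * n ≤ centeredSum ν X φ I k i t ω} with hE
  have hEm : ∀ n, MeasurableSet (E n) := fun n ↦ measurableSet_exists_numObs_eq h δ k i T n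
  have hOm : ∀ t, MeasurableSet (underestimated ν σ ξ X φ I k j t) :=
    fun t ↦ measurableSet_underestimated h k j t
  have hle : ∀ ω, (numChoices φ k i T ω : ℝ) ≤ (η + 1) +
      ∑ t ∈ Ico 1 T, (underestimated ν σ ξ X φ I k j t).indicator (fun _ ↦ (1 : ℝ)) ω +
      ∑ n ∈ Icc 1 M, (E n).indicator (fun _ ↦ (1 : ℝ)) ω := by
    intro ω
    refine (numChoices_le_add hU hα hξ hσ hD hij ha T ω).trans ?_
    gcongr
    · exact (sum_choice_numObs_le h.link_self k i η hη0 T ω).trans (min_le_right _ _)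
    · exact sum_choice_overestimated_le h.link_self k i hη0 fun t ht ↦
        (numObs_le_mul G h.link_nonadj k i t ω).trans (Nat.mul_le_mul_left _ ht)
  have hiO : Integrable (fun ω ↦ ∑ t ∈ Ico 1 T,
      (underestimated ν σ ξ X φ I k j t).indicator (fun _ ↦ (1 : ℝ)) ω) P :=
    integrable_finsetSum _ fun t _ ↦ (integrable_const _).indicator (hOm t)
  have hiE : Integrable (fun ω ↦ ∑ n ∈ Icc 1 M, (E n).indicator (fun _ ↦ (1 : ℝ)) ω) P :=
    integrable_finsetSum _ fun t _ ↦ (integrable_const _).indicator (hEm t)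
  refine (integral_mono (integrable_numChoices h k i T)
    (((integrable_const _).add hiO).add hiE) hle).trans ?_
  have hsplit := integral_add (μ := P) ((integrable_const (η + 1)).add hiO) hiE
  have hsplit2 := integral_add (μ := P) (integrable_const (η + 1)) hiO
  simp only [Pi.add_apply] at hsplit hsplit2 ⊢
  rw [hsplit, hsplit2, integral_finsetSum _ fun t _ ↦ (integrable_const _).indicator (hOm t),
    integral_finsetSum _ fun t _ ↦ (integrable_const _).indicator (hEm t)]
  simp only [integral_indicator_const _ (hOm _), integral_indicator_const _ (hEm _),
    smul_eq_mul, mul_one, integral_const, probReal_univ, one_mul]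
  gcongr
  · exact sum_measureReal_underestimated_le hν h hξ k hk j T
  -- Summing over sample sizes gives a geometric series, bounded by `1/r`. This is independent of
  -- `T` but proportional to `σ²/D²`, so it must later be absorbed by the leading term.
  · set r := δ ^ 2 / (2 * (σ i : ℝ) ^ 2) with hr
    have hr0 : 0 < r := by positivity
    have hgeo : ∑ n ∈ Icc 1 M, Real.exp (-(n * r)) ≤ 1 / r := by
      rw [sum_Icc_one_eq_sum_range (fun n ↦ Real.exp (-(n * r)))]
      have hx0 := Real.exp_pos (-r)
      have hx1 : Real.exp (-r) < 1 := by rw [Real.exp_lt_one_iff]; linarith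
      have h1 : ∀ n ∈ range M, Real.exp (-(((n + 1 : ℕ) : ℝ) * r)) =
          Real.exp (-r) * Real.exp (-r) ^ n := by
        intro n _
        rw [← Real.exp_nat_mul, ← Real.exp_add]
        congr 1; push_cast; ring
      rw [sum_congr rfl h1, ← mul_sum]
      have h2 : ∑ n ∈ range M, Real.exp (-r) ^ n ≤ (1 - Real.exp (-r))⁻¹ := by
        rw [← tsum_geometric_of_lt_one hx0.le hx1]
        exact (summable_geometric_of_lt_one hx0.le hx1).sum_le_tsum _ fun n _ ↦ by positivity
      refine (mul_le_mul_of_nonneg_left h2 hx0.le).trans ?_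
      rw [← div_eq_mul_inv, div_le_div_iff₀ (by linarith) hr0]
      have h3 : Real.exp (-r) * (1 + r) ≤ 1 := by
        calc Real.exp (-r) * (1 + r) ≤ Real.exp (-r) * Real.exp r := by
              gcongr; linarith [Real.add_one_le_exp r]
          _ = 1 := by rw [← Real.exp_add, neg_add_cancel, Real.exp_zero]
      nlinarith
    calc ∑ n ∈ Icc 1 M, P.real (E n) ≤ ∑ n ∈ Icc 1 M, Real.exp (-(n * r)) :=
          sum_le_sum fun n _ ↦
            measureReal_exists_numObs_eq_centeredSum_ge_le hν h k i T n hδ0.le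
      _ ≤ 1 / r := hgeo
      _ = _ := by
        have : a - 1 ≠ 0 := by linarith
        have h4 : a ≠ 0 := by linarith
        rw [hr, hδ, show 1 - 1 / a = (a - 1) / a by field_simp]
        field_simp

end Expectations

end MultiStar

namespace MultiStar

open Finset

/-! ### Shared observations in a complete graph -/

section CompleteGraph

variable {Ω : Type u} {K N : ℕ} {φ : ℕ → Fin K → Ω → Fin N}
  {I : ℕ → Fin K → Fin K → Ω → Bool}

/-- The agents that choose option `i` in round `t + 1` having at most `b` observations of it. -/
noncomputable def lowSet (φ : ℕ → Fin K → Ω → Fin N) (I : ℕ → Fin K → Fin K → Ω → Bool)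
    (i : Fin N) (b : ℝ) (t : ℕ) (ω : Ω) : Finset (Fin K) :=
  open scoped Classical in
  univ.filter fun k ↦ φ (t + 1) k ω = i ∧ (numObs φ I k i t ω : ℝ) ≤ b

theorem mem_lowSet {i : Fin N} {b : ℝ} {t : ℕ} {ω : Ω} {k : Fin K} :
    k ∈ lowSet φ I i b t ω ↔ φ (t + 1) k ω = i ∧ (numObs φ I k i t ω : ℝ) ≤ b := by
  simp [lowSet]

/-- The group total of the choices of option `i` in the first `t` rounds by agents having at most
`b` observations of it. -/
noncomputable def lowCount (φ : ℕ → Fin K → Ω → Fin N) (I : ℕ → Fin K → Fin K → Ω → Bool)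
    (i : Fin N) (b : ℝ) (t : ℕ) (ω : Ω) : ℝ :=
  ∑ s ∈ range t, (#(lowSet φ I i b s ω) : ℝ)

theorem lowCount_mono (i : Fin N) (b : ℝ) (ω : Ω) : Monotone fun t ↦ lowCount φ I i b t ω :=
  fun _ _ hst ↦ sum_le_sum_of_subset_of_nonneg (range_subset_range.2 hst)
    fun _ _ _ ↦ Nat.cast_nonneg _

/-- The outcomes for which agent `k` still has at most `b` observations of option `i` at a time
when the group total exceeds `x`. -/
def starved (φ : ℕ → Fin K → Ω → Fin N) (I : ℕ → Fin K → Fin K → Ω → Bool)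
    (i : Fin N) (b x : ℝ) (T : ℕ) (k : Fin K) : Set Ω :=
  {ω | ∃ t < T, (numObs φ I k i t ω : ℝ) ≤ b ∧ x < lowCount φ I i b t ω}

/-- While the group total of low choices is at most `x`, it can overshoot by at most one round, that
is by `K`. An agent making a low choice later is starved, and it makes at most `b + 1` low choices
in all. -/
theorem sum_card_lowSet_le (hI : ∀ t k ω, I (t + 1) k k ω = true) (i : Fin N) {b x : ℝ}
    (hb : 0 ≤ b) (hx : 0 ≤ x) (T : ℕ) (ω : Ω) :
    ∑ k, ∑ t ∈ range T,
      (if φ (t + 1) k ω = i ∧ (numObs φ I k i t ω : ℝ) ≤ b then (1 : ℝ) else 0) ≤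
      (x + K) + ∑ k, (starved φ I i b x T k).indicator (fun _ ↦ b + 1) ω := by
  have hcard : ∀ t, (#(lowSet φ I i b t ω) : ℝ) = ∑ k, if φ (t + 1) k ω = i ∧
      (numObs φ I k i t ω : ℝ) ≤ b then (1 : ℝ) else 0 := by
    intro t
    rw [lowSet, card_filter]
    push_cast
    exact sum_congr rfl fun k _ ↦ by congr
  have hK : ∀ t, (#(lowSet φ I i b t ω) : ℝ) ≤ K := by
    intro t
    exact_mod_cast (card_le_univ _).trans (Fintype.card_fin K).le
  have h1 := (sum_truncated_le (z := fun s ↦ (#(lowSet φ I i b s ω) : ℝ))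
    (fun s ↦ Nat.cast_nonneg _) hK hx T).trans (min_le_right _ _)
  have h2 : ∀ k t, t ∈ range T → (if φ (t + 1) k ω = i ∧ (numObs φ I k i t ω : ℝ) ≤ b then (1 : ℝ)
      else 0) ≤ (if lowCount φ I i b t ω ≤ x then (if φ (t + 1) k ω = i ∧
        (numObs φ I k i t ω : ℝ) ≤ b then (1 : ℝ) else 0) else 0) +
      (starved φ I i b x T k).indicator (fun _ ↦ (if φ (t + 1) k ω = i ∧
        (numObs φ I k i t ω : ℝ) ≤ b then (1 : ℝ) else 0)) ω := by
    intro k t ht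
    have h0 : (0 : ℝ) ≤ if φ (t + 1) k ω = i ∧ (numObs φ I k i t ω : ℝ) ≤ b then (1 : ℝ)
      else 0 := by split_ifs <;> simp
    by_cases hx' : lowCount φ I i b t ω ≤ x
    · rw [if_pos hx']
      exact le_add_of_nonneg_right (Set.indicator_nonneg (fun _ _ ↦ h0) _)
    · by_cases hlow : φ (t + 1) k ω = i ∧ (numObs φ I k i t ω : ℝ) ≤ b
      · have hst : ω ∈ starved φ I i b x T k :=
          ⟨t, mem_range.1 ht, hlow.2, not_le.1 hx'⟩
        rw [Set.indicator_of_mem hst, if_neg hx', zero_add]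
      · simp [hlow]
  calc _ ≤ ∑ k, ∑ t ∈ range T, ((if lowCount φ I i b t ω ≤ x then (if φ (t + 1) k ω = i ∧
        (numObs φ I k i t ω : ℝ) ≤ b then (1 : ℝ) else 0) else 0) +
      (starved φ I i b x T k).indicator (fun _ ↦ (if φ (t + 1) k ω = i ∧
        (numObs φ I k i t ω : ℝ) ≤ b then (1 : ℝ) else 0)) ω) :=
        sum_le_sum fun k _ ↦ sum_le_sum (h2 k)
    _ = ∑ t ∈ range T, (if lowCount φ I i b t ω ≤ x then (#(lowSet φ I i b t ω) : ℝ) else 0) +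
        ∑ k, ∑ t ∈ range T, (starved φ I i b x T k).indicator (fun _ ↦ (if φ (t + 1) k ω = i ∧
        (numObs φ I k i t ω : ℝ) ≤ b then (1 : ℝ) else 0)) ω := by
        simp_rw [sum_add_distrib]
        congr 1
        rw [sum_comm]
        refine sum_congr rfl fun t _ ↦ ?_
        rw [hcard t]
        split_ifs <;> simp
    _ ≤ _ := by
        refine add_le_add h1 (sum_le_sum fun k _ ↦ ?_)
        by_cases hω : ω ∈ starved φ I i b x T k
        · simp only [Set.indicator_of_mem hω]
          exact (sum_choice_numObs_le hI k i b hb T ω).trans (min_le_right _ _)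
        · simp [Set.indicator_of_notMem hω]

variable [mΩ : MeasurableSpace Ω] {P : Measure Ω}
  {ℱ : Filtration ℕ mΩ} {G : SimpleGraph (Fin K)} {p ξ : ℝ}
  {ν : Fin N → Measure ℝ} {σ : Fin N → ℝ≥0} {α : Fin K → ℝ}
  {X : ℕ → Fin K → Fin N → Ω → ℝ}

theorem measurableSet_lowSet_eq (h : IsBroadcastBandit P ℱ G p ν X φ I) (i : Fin N) (b : ℝ)
    (t : ℕ) (s : Finset (Fin K)) : MeasurableSet[ℱ t] {ω | lowSet φ I i b t ω = s} := by
  have : {ω | lowSet φ I i b t ω = s} =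
      ⋂ k, {ω | (φ (t + 1) k ω = i ∧ (numObs φ I k i t ω : ℝ) ≤ b) ↔ k ∈ s} := by
    ext ω
    simp [mem_lowSet, Finset.ext_iff]
  rw [this]
  refine MeasurableSet.iInter fun k ↦ ?_
  have hk : MeasurableSet[ℱ t] {ω | φ (t + 1) k ω = i ∧ (numObs φ I k i t ω : ℝ) ≤ b} :=
    MeasurableSet.inter (h.choice_measurable t k (measurableSet_singleton i))
      (measurable_numObs h k i t (MeasurableSet.of_discrete (s := {n : ℕ | (n : ℝ) ≤ b})))
  by_cases hks : k ∈ s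
  · simpa [hks] using hk
  · simp only [hks, iff_false]
    exact hk.compl

theorem measurable_lowCount (h : IsBroadcastBandit P ℱ G p ν X φ I) (i : Fin N) (b : ℝ)
    (t : ℕ) : Measurable[ℱ t] (lowCount φ I i b t) := by
  classical
  unfold lowCount
  refine Finset.measurable_fun_sum _ fun s hs ↦ ?_
  have : (fun ω ↦ (#(lowSet φ I i b s ω) : ℝ)) = fun ω ↦ ∑ J : Finset (Fin K),
      Set.indicator {ω | lowSet φ I i b s ω = J} (fun _ ↦ (#J : ℝ)) ω := by
    funext ω
    simp [Set.indicator_apply]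
  rw [this]
  refine Finset.measurable_fun_sum _ fun J _ ↦ ?_
  exact measurable_const.indicator
    (ℱ.mono (mem_range.1 hs).le _ (measurableSet_lowSet_eq h i b s J))

theorem measurableSet_starved (h : IsBroadcastBandit P ℱ G p ν X φ I) (i : Fin N) (b x : ℝ)
    (T : ℕ) (k : Fin K) : MeasurableSet (starved φ I i b x T k) := by
  have : starved φ I i b x T k = ⋃ t ∈ Set.Iio T,
      {ω | (numObs φ I k i t ω : ℝ) ≤ b ∧ x < lowCount φ I i b t ω} := by
    ext ω
    simp only [starved, Set.mem_ofPred_eq, Set.mem_iUnion, Set.mem_Iio, exists_prop]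
  rw [this]
  refine MeasurableSet.biUnion (Set.to_countable _) fun t _ ↦ ?_
  exact MeasurableSet.inter (ℱ.le _ _ (measurable_numObs h k i t
    (MeasurableSet.of_discrete (s := {n : ℕ | (n : ℝ) ≤ b}))))
    (measurableSet_lt measurable_const ((measurable_lowCount h i b t).mono (ℱ.le _) le_rfl))

/-- In a complete graph it is exponentially unlikely that an agent is left with few
observations. -/
theorem measureReal_starved_le [IsProbabilityMeasure P] (hp0 : 0 < p) (hp1 : p ≤ 1)
    (hG : ∀ k j, k ≠ j → G.Adj k j) (h : IsBroadcastBandit P ℱ G p ν X φ I) (i : Fin N)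
    {b x : ℝ} (hx : 0 ≤ x) (T : ℕ) (k : Fin K) {θ : ℝ} (hθ : 0 ≤ θ) :
    P.real (starved φ I i b x T k) ≤ Real.exp (-(p * (1 - Real.exp (-θ)) * x - θ * b)) := by
  classical
  -- Once the group total exceeds `x` the index set is empty, so the link sum at `T` equals the one
  -- at the unknown starvation time.
  set J : ℕ → Ω → Finset (Fin K) := fun t ω ↦
    if lowCount φ I i b t ω ≤ x then lowSet φ I i b t ω else ∅ with hJ
  have hJm : ∀ t s, MeasurableSet[ℱ t] {ω | J t ω = s} := by
    intro t s
    have hc : MeasurableSet[ℱ t] {ω | lowCount φ I i b t ω ≤ x} :=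
      measurable_lowCount h i b t measurableSet_Iic
    have : {ω | J t ω = s} =
        ({ω | lowCount φ I i b t ω ≤ x} ∩ {ω | lowSet φ I i b t ω = s}) ∪
        ({ω | lowCount φ I i b t ω ≤ x}ᶜ ∩ {_ω | ∅ = s}) := by
      ext ω
      by_cases hω : lowCount φ I i b t ω ≤ x <;> simp [hJ, hω]
    rw [this]
    exact (hc.inter (measurableSet_lowSet_eq h i b t s)).union
      (hc.compl.inter (MeasurableSet.const _))
  refine (measureReal_mono ?_ (measure_ne_top _ _)).trans
    (measureReal_link_sum_ge_le hp1 hG h k hθ J hJm T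
      (p * (1 - Real.exp (-θ)) * x - θ * b))
  rintro ω ⟨t, htT, hnt, hxt⟩
  rw [Set.mem_ofPred_eq]
  set q := p * (1 - Real.exp (-θ)) with hq
  have hq0 : 0 ≤ q := mul_nonneg hp0.le
    (by linarith [Real.exp_le_one_iff.2 (neg_nonpos.2 hθ)])
  have hrest : ∑ s ∈ range T, ∑ j ∈ J s ω, (q - if I (s + 1) k j ω = true then θ else 0) =
      ∑ s ∈ range t, ∑ j ∈ J s ω, (q - if I (s + 1) k j ω = true then θ else 0) := by
    symm
    refine sum_subset (range_subset_range.2 htT.le) fun s _ hs ↦ ?_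
    have h1 : t ≤ s := not_lt.1 fun hlt ↦ hs (mem_range.2 hlt)
    have h2 : J s ω = ∅ :=
      if_neg (not_le.2 (hxt.trans_le (lowCount_mono i b ω h1)))
    rw [h2, sum_empty]
  have h1 : q * x ≤ ∑ s ∈ range t, ∑ j ∈ J s ω, q := by
    have h3 := (lt_sum_truncated (z := fun s ↦ (#(lowSet φ I i b s ω) : ℝ)) hx hxt
      fun s ↦ Nat.cast_nonneg _).le
    have h4 : ∑ s ∈ range t, ∑ j ∈ J s ω, q = q * ∑ s ∈ range t,
        (if ∑ r ∈ range s, (#(lowSet φ I i b r ω) : ℝ) ≤ x then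
          (#(lowSet φ I i b s ω) : ℝ) else 0) := by
      rw [mul_sum]
      refine sum_congr rfl fun s _ ↦ ?_
      rw [sum_const, nsmul_eq_mul, mul_comm]
      congr 1
      by_cases hs : lowCount φ I i b s ω ≤ x
      · rw [if_pos (by exact hs), hJ]; simp [hs]
      · rw [if_neg (by exact hs), hJ]; simp [hs]
    rw [h4]
    exact mul_le_mul_of_nonneg_left h3 hq0
  have h2 : ∑ s ∈ range t, ∑ j ∈ J s ω, (if I (s + 1) k j ω = true then θ else 0) ≤ θ * b := by
    refine le_trans ?_ (mul_le_mul_of_nonneg_left hnt hθ)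
    rw [numObs, sum_Icc_one_eq_sum_range]
    push_cast
    rw [mul_sum]
    refine sum_le_sum fun s _ ↦ ?_
    have h5 : J s ω ⊆ univ.filter fun j ↦ φ (s + 1) j ω = i := by
      intro j hj
      have : j ∈ lowSet φ I i b s ω := by
        rw [hJ] at hj
        dsimp only at hj
        split_ifs at hj with hc
        · exact hj
        · simp at hj
      simpa using (mem_lowSet.1 this).1
    refine (sum_le_sum_of_subset_of_nonneg h5 fun j _ _ ↦ by split_ifs <;> simp [hθ]).trans ?_
    rw [sum_filter, mul_sum]
    refine sum_le_sum fun j _ ↦ ?_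
    by_cases h6 : φ (s + 1) j ω = i <;> by_cases h7 : I (s + 1) k j ω = true <;> simp [h6, h7]
  rw [hrest]
  simp_rw [sum_sub_distrib] at *
  linarith

variable [DecidableRel G.Adj]

/-- Expected group total of the choices of a suboptimal option in a complete graph, using the
shared observations. -/
theorem sum_integral_numChoices_le_of_complete [IsProbabilityMeasure P]
    (hν : IsSubgaussianBandit ν σ) (hp0 : 0 < p) (hp1 : p ≤ 1)
    (hG : ∀ k j, k ≠ j → G.Adj k j) (h : IsBroadcastBandit P ℱ G p ν X φ I)
    (hU : FollowsUCB σ α ξ X φ I) (hα : ∀ k, α k = 0) (hξ : 1 < ξ)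
    {i j : Fin N} {D : ℝ} (hD : 0 < D)
    (hij : meanReward ν j = meanReward ν i + D) {a : ℝ} (ha : 1 < a) (ha2 : 1 / 2 ≤ (a - 1) ^ 2)
    (hdeg : ∀ k, 1 ≤ G.degree k) {T : ℕ} (hT : 1 ≤ T) :
    ∑ k, ∫ ω, (numChoices φ k i T ω : ℝ) ∂P ≤
      1.01 * threshold a ((σ i : ℝ) ^ 2 / D ^ 2) ξ T / p + 40203 * K +
      ∑ k, 12 * (∑' t : ℕ, (t : ℝ) ^ (-(5 / 4) : ℝ)) * Real.log (1 + G.degree k) := by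
  have hσ := hν.sigma_pos i
  have hσ' : (0 : ℝ) < σ i := hσ
  set b := threshold a ((σ i : ℝ) ^ 2 / D ^ 2) ξ T with hb
  have hb0 : 0 ≤ b := threshold_nonneg (by positivity) hξ T
  set x := 1.01 * b / p with hx
  have hx0 : 0 ≤ x := by positivity
  set δ := D * (1 - 1 / a) with hδ
  have ha0 : 0 < 1 - 1 / a := by
    rw [sub_pos, div_lt_one (by linarith)]; exact ha
  have hδ0 : 0 < δ := mul_pos hD ha0
  set O : Fin K → ℕ → Set Ω := fun k t ↦ underestimated ν σ ξ X φ I k j t with hO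
  set E : Fin K → ℕ → Set Ω := fun k t ↦ overestimated ν X φ I b δ k i t with hE
  set V : Fin K → Set Ω := fun k ↦ starved φ I i b x T k with hV
  have hOm : ∀ k t, MeasurableSet (O k t) := fun k t ↦ measurableSet_underestimated h k j t
  have hEm : ∀ k t, MeasurableSet (E k t) := fun k t ↦ measurableSet_overestimated h b δ k i t
  have hVm : ∀ k, MeasurableSet (V k) := fun k ↦ measurableSet_starved h i b x T k
  have hle : ∀ ω, ∑ k, (numChoices φ k i T ω : ℝ) ≤ (x + K) +
      ∑ k, ((V k).indicator (fun _ ↦ b + 1) ω +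
        (∑ t ∈ Ico 1 T, (O k t).indicator (fun _ ↦ (1 : ℝ)) ω +
        ∑ t ∈ Ico 1 T, (E k t).indicator (fun _ ↦ (1 : ℝ)) ω)) := by
    intro ω
    have h1 := sum_card_lowSet_le (φ := φ) (I := I) h.link_self i hb0 hx0 T ω
    have h2 : ∀ k ∈ univ, (numChoices φ k i T ω : ℝ) ≤
        ∑ t ∈ range T, (if φ (t + 1) k ω = i ∧ (numObs φ I k i t ω : ℝ) ≤ b then (1 : ℝ) else 0) +
        (∑ t ∈ Ico 1 T, (O k t).indicator (fun _ ↦ (1 : ℝ)) ω +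
        ∑ t ∈ Ico 1 T, (E k t).indicator (fun _ ↦ (1 : ℝ)) ω) := by
      intro k _
      have h3 := numChoices_le_add hU (hα k).ge hξ hσ hD hij ha T ω
      rw [hα k, add_zero, one_mul, add_assoc] at h3
      refine h3.trans ?_
      gcongr with t _
      split_ifs
      · exact le_rfl
      · exact Set.indicator_nonneg (fun _ _ ↦ zero_le_one) _
    refine (sum_le_sum h2).trans ?_
    rw [sum_add_distrib, sum_add_distrib (g := fun k ↦ _ + _), ← add_assoc]
    exact add_le_add_left h1 _
  have hiV : ∀ k, Integrable (fun ω ↦ (V k).indicator (fun _ ↦ b + 1) ω) P :=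
    fun k ↦ (integrable_const _).indicator (hVm k)
  have hiO : ∀ k, Integrable (fun ω ↦ ∑ t ∈ Ico 1 T, (O k t).indicator (fun _ ↦ (1 : ℝ)) ω) P :=
    fun k ↦ integrable_finsetSum _ fun t _ ↦ (integrable_const _).indicator (hOm k t)
  have hiE : ∀ k, Integrable (fun ω ↦ ∑ t ∈ Ico 1 T, (E k t).indicator (fun _ ↦ (1 : ℝ)) ω) P :=
    fun k ↦ integrable_finsetSum _ fun t _ ↦ (integrable_const _).indicator (hEm k t)
  -- With `θ = 1/200` one has `1 - exp (-θ) ≥ 1/201`, and `1.01/201 - 1/200 = 1/40200`: the one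
  -- percent margin in `x` gives exponential decay in `b`.
  have hPV : ∀ k, P.real (V k) * (b + 1) ≤ 40201 := by
    intro k
    have h1 := measureReal_starved_le hp0 hp1 hG h i (b := b) hx0 T k (θ := 1 / 200) (by norm_num)
    have h2 : Real.exp (-(p * (1 - Real.exp (-(1 / 200))) * x - 1 / 200 * b)) ≤
        Real.exp (-(b / 40200)) := by
      refine Real.exp_le_exp.2 (neg_le_neg ?_)
      have h3 : Real.exp (-(1 / 200)) ≤ 200 / 201 := by
        rw [Real.exp_neg, inv_le_comm₀ (Real.exp_pos _) (by norm_num)]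
        have := Real.add_one_le_exp (1 / 200 : ℝ)
        norm_num at this ⊢
        linarith
      have h4 : p * (1 - Real.exp (-(1 / 200))) * x = (1 - Real.exp (-(1 / 200))) * (1.01 * b) := by
        rw [hx]; field_simp
      rw [h4]
      nlinarith [mul_le_mul_of_nonneg_right h3 hb0]
    have h5 : Real.exp (-(b / 40200)) * (b + 1) ≤ 40201 := by
      have h6 : b + 1 ≤ 40201 * Real.exp (b / 40200) := by
        linarith [Real.add_one_le_exp (b / 40200)]
      calc Real.exp (-(b / 40200)) * (b + 1) ≤
            Real.exp (-(b / 40200)) * (40201 * Real.exp (b / 40200)) := by gcongr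
        _ = 40201 := by
          rw [mul_left_comm, ← Real.exp_add, neg_add_cancel, Real.exp_zero, mul_one]
    refine le_trans ?_ h5
    gcongr
    exact h1.trans h2
  -- Because `(a - 1)²(ξ + 1) ≥ 1`, each overestimation has probability at most `1/T`. Unlike the
  -- geometric series, this leaves no multiple of `σ²/D²`.
  have hPE : ∀ k, ∑ t ∈ Ico 1 T, P.real (E k t) ≤ 1 := by
    intro k
    have hT' : (1 : ℝ) ≤ T := by exact_mod_cast hT
    have hlT := Real.log_nonneg hT'
    have h1 : ∀ t ∈ Ico 1 T, P.real (E k t) ≤ (T : ℝ)⁻¹ := by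
      intro t _
      refine (measureReal_numObs_gt_centeredSum_ge_le hν h k i t b hδ0.le).trans ?_
      rw [show (T : ℝ)⁻¹ = Real.exp (-Real.log T) by
        rw [Real.exp_neg, Real.exp_log (by linarith)]]
      refine Real.exp_le_exp.2 (neg_le_neg ?_)
      have h2 : b * (δ ^ 2 / (2 * (σ i : ℝ) ^ 2)) = (a - 1) ^ 2 * (ξ + 1) * Real.log T := by
        have h4 : a ≠ 0 := by linarith
        rw [hb, hδ, threshold, show 1 - 1 / a = (a - 1) / a by field_simp]
        field_simp
      rw [h2]
      have h3 : 1 ≤ (a - 1) ^ 2 * (ξ + 1) := by nlinarith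
      exact le_mul_of_one_le_left hlT h3
    refine (sum_le_sum h1).trans ?_
    rw [sum_const, Nat.card_Ico, nsmul_eq_mul, ← div_eq_mul_inv]
    refine div_le_one_of_le₀ ?_ (by linarith)
    exact_mod_cast Nat.sub_le T 1
  have hisum := fun k ↦ (hiV k).add ((hiO k).add (hiE k))
  simp only [Pi.add_def] at hisum
  have hint : ∑ k, ∫ ω, (numChoices φ k i T ω : ℝ) ∂P ≤ (x + K) +
      ∑ k, (P.real (V k) * (b + 1) + (∑ t ∈ Ico 1 T, P.real (O k t) +
        ∑ t ∈ Ico 1 T, P.real (E k t))) := by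
    rw [← integral_finsetSum _ fun k _ ↦ integrable_numChoices h k i T]
    refine (integral_mono (integrable_finsetSum _ fun k _ ↦ integrable_numChoices h k i T)
      ((integrable_const _).add (integrable_finsetSum _ fun k _ ↦ hisum k)) hle).trans ?_
    refine le_of_eq ?_
    simp only [Pi.add_apply]
    rw [integral_add (integrable_const _) (integrable_finsetSum _ fun k _ ↦ hisum k),
      integral_finsetSum _ fun k _ ↦ hisum k]
    congr 1
    · simp
    · refine sum_congr rfl fun k _ ↦ ?_
      have hOE := (hiO k).add (hiE k)
      simp only [Pi.add_def] at hOE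
      rw [integral_add (hiV k) hOE, integral_add (hiO k) (hiE k),
        integral_finsetSum _ fun t _ ↦ (integrable_const _).indicator (hOm k t),
        integral_finsetSum _ fun t _ ↦ (integrable_const _).indicator (hEm k t)]
      simp only [integral_indicator_const _ (hOm _ _), integral_indicator_const _ (hEm _ _),
        integral_indicator_const _ (hVm _), smul_eq_mul, mul_one]
  refine hint.trans ?_
  have hfin : ∑ k, (P.real (V k) * (b + 1) + (∑ t ∈ Ico 1 T, P.real (O k t) +
        ∑ t ∈ Ico 1 T, P.real (E k t))) ≤ ∑ k : Fin K, (40202 +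
      12 * (∑' t : ℕ, (t : ℝ) ^ (-(5 / 4) : ℝ)) * Real.log (1 + G.degree k)) := by
    refine sum_le_sum fun k _ ↦ ?_
    have := sum_measureReal_underestimated_le hν h hξ k (hdeg k) j T
    linarith [hPV k, hPE k]
  refine (add_le_add_right hfin _).trans (le_of_eq ?_)
  rw [sum_add_distrib, sum_const, card_univ, Fintype.card_fin, nsmul_eq_mul]
  ring

end CompleteGraph

end MultiStar

namespace MultiStar

open Finset

/-! ### Degrees and exploration biases of multi-stars -/

section Graph

variable {K m : ℕ} {G : SimpleGraph (Fin K)} [DecidableRel G.Adj]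

theorem IsSymmetricMultiStar.one_le_degree (hG : IsSymmetricMultiStar G m) (hK : 2 ≤ K)
    (k : Fin K) : 1 ≤ G.degree k := by
  refine Nat.succ_le_of_lt ((G.degree_pos_iff_exists_adj k).2 ?_)
  rcases lt_or_ge k.val m with hk | hk
  · have hm := hG.one_le
    rcases Nat.eq_or_lt_of_le hm with h1 | h2
    -- With a single center, agent `1` is peripheral, and its neighbor can only be that center.
    · obtain ⟨c, hc, hadj⟩ := hG.peripheral ⟨1, by omega⟩ h1.ge
      have hck : c = k := Fin.ext (by omega)
      exact ⟨_, ((hadj k).2 hck.symm).symm⟩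
    · by_cases h0 : k.val = 0
      · exact ⟨⟨1, by omega⟩, hG.center_adj k _ hk h2 fun h ↦ by
          rw [h] at h0; simp at h0⟩
      · exact ⟨⟨0, by omega⟩, hG.center_adj k _ hk (by simp; omega) fun h ↦ h0 (by rw [h])⟩
  · obtain ⟨c, -, hadj⟩ := hG.peripheral k hk
    exact ⟨c, (hadj c).2 rfl⟩

theorem IsSymmetricMultiStar.degree_le_center (hG : IsSymmetricMultiStar G m) (hK : 2 ≤ K)
    {c : Fin K} (hc : c.val < m) (k : Fin K) : G.degree k ≤ G.degree c := by
  rcases lt_or_ge k.val m with hk | hk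
  · exact (hG.symmetric k c hk hc).le
  · obtain ⟨c', -, hadj⟩ := hG.peripheral k hk
    have : G.neighborFinset k = {c'} := by
      ext j; simp [hadj]
    rw [← G.card_neighborFinset_eq_degree, this, card_singleton]
    exact hG.one_le_degree hK c

theorem neighborAvgDegree_le {k : Fin K} (hk : ∀ j, G.degree j ≤ G.degree k) :
    neighborAvgDegree G k ≤ G.degree k := by
  refine div_le_of_le_mul₀ (Nat.cast_nonneg _) (Nat.cast_nonneg _) ?_
  calc ∑ j ∈ G.neighborFinset k, (G.degree j : ℝ)
      ≤ ∑ j ∈ G.neighborFinset k, (G.degree k : ℝ) :=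
        sum_le_sum fun j _ ↦ Nat.cast_le.2 (hk j)
    _ = _ := by simp

/-- A center has maximal degree, so its neighbors' average degree does not exceed its own. -/
theorem IsSymmetricMultiStar.explorationBias_nonneg (hG : IsSymmetricMultiStar G m) (hK : 2 ≤ K)
    {p : ℝ} (hp : 0 ≤ p) (k : Fin K) : 0 ≤ explorationBias G m p k := by
  unfold explorationBias
  split_ifs with hk
  · have := neighborAvgDegree_le (hG.degree_le_center hK hk)
    exact div_nonneg (mul_nonneg (Real.rpow_nonneg hp _) (by linarith)) (Nat.cast_nonneg _)
  · exact le_rfl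

theorem IsSymmetricMultiStar.explorationBias_le_one (hG : IsSymmetricMultiStar G m) (hK : 2 ≤ K)
    {p : ℝ} (hp : 0 ≤ p) (hp1 : p ≤ 1) (k : Fin K) : explorationBias G m p k ≤ 1 := by
  unfold explorationBias
  split_ifs with hk
  · have h1 := neighborAvgDegree_le (hG.degree_le_center hK hk)
    have h2 : 0 ≤ neighborAvgDegree G k :=
      div_nonneg (sum_nonneg fun _ _ ↦ Nat.cast_nonneg _) (Nat.cast_nonneg _)
    refine div_le_one_of_le₀ ?_ (Nat.cast_nonneg _)
    exact (mul_le_of_le_one_left (by linarith) (Real.rpow_le_one hp hp1 (by linarith))).trans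
      (by linarith)
  · exact zero_le_one

/-- Without peripheral agents all degrees coincide, hence also the neighbors' average. -/
theorem IsSymmetricMultiStar.explorationBias_eq_zero (hG : IsSymmetricMultiStar G K) (hK : 2 ≤ K)
    (p : ℝ) (k : Fin K) : explorationBias G K p k = 0 := by
  have hdeg : (G.degree k : ℝ) ≠ 0 := by
    have := hG.one_le_degree hK k
    exact_mod_cast (by omega : G.degree k ≠ 0)
  have : neighborAvgDegree G k = G.degree k := by
    unfold neighborAvgDegree
    rw [sum_congr rfl fun j _ ↦ by rw [hG.symmetric j k j.2 k.2]]
    rw [sum_const, G.card_neighborFinset_eq_degree, nsmul_eq_mul]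
    field_simp
  simp [explorationBias, this]

/-- If there are peripheral agents, there are at least as many of them as centers. -/
theorem IsSymmetricMultiStar.two_mul_le (hG : IsSymmetricMultiStar G m) (hm : m < K) :
    2 * m ≤ K := by
  classical
  set C : Finset (Fin K) := univ.filter fun k ↦ k.val < m with hC
  have hCcard : #C = m := by
    have h1 : C = Finset.Iio ⟨m, hm⟩ := by
      ext k; simp [hC, Fin.lt_def]
    rw [h1, Fin.card_Iio]
  obtain ⟨c₀, hc₀, hadj₀⟩ := hG.peripheral ⟨m, hm⟩ le_rfl
  -- The center attached to one peripheral agent has this neighbor besides the `m - 1` other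
  -- centers. By equality of degrees every center then needs a peripheral neighbor.
  have hdeg₀ : m ≤ G.degree c₀ := by
    have hnot : (⟨m, hm⟩ : Fin K) ∉ C.erase c₀ := by simp [hC]
    have h2 : insert ⟨m, hm⟩ (C.erase c₀) ⊆ G.neighborFinset c₀ := by
      intro j hj
      rw [SimpleGraph.mem_neighborFinset]
      rcases mem_insert.1 hj with rfl | hj
      · exact ((hadj₀ c₀).2 rfl).symm
      · obtain ⟨hne, hj⟩ := mem_erase.1 hj
        exact hG.center_adj _ _ hc₀ (mem_filter.1 hj).2 hne.symm
    have h3 := card_le_card h2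
    rw [card_insert_of_notMem hnot, card_erase_of_mem (by simp [hC, hc₀]), hCcard,
      G.card_neighborFinset_eq_degree] at h3
    have := hG.one_le
    omega
  have hex : ∀ c : Fin K, c.val < m → ∃ j : Fin K, m ≤ j.val ∧ G.Adj c j := by
    intro c hc
    by_contra! hcon
    have h2 : G.neighborFinset c ⊆ C.erase c := by
      intro j hj
      rw [SimpleGraph.mem_neighborFinset] at hj
      refine mem_erase.2 ⟨hj.ne', mem_filter.2 ⟨mem_univ _, ?_⟩⟩
      by_contra hjm
      exact hcon j (not_lt.1 hjm) hj
    have h3 := card_le_card h2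
    rw [card_erase_of_mem (by simp [hC, hc]), hCcard, G.card_neighborFinset_eq_degree,
      hG.symmetric c c₀ hc hc₀] at h3
    have := hG.one_le
    omega
  choose! f hf using hex
  have hcard : #C ≤ #Cᶜ := by
    -- Injectivity holds because a peripheral agent has only one neighbor.
    refine card_le_card_of_injOn f (fun c hc ↦ ?_) fun c hc c' hc' heq ↦ ?_
    · have := (hf c (mem_filter.1 hc).2).1
      simp [hC, this]
    · have h1 := hf c (mem_filter.1 hc).2
      have h2 := hf c' (mem_filter.1 hc').2
      obtain ⟨d, -, hd⟩ := hG.peripheral (f c) h1.1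
      rw [(hd c).1 h1.2.symm, (hd c').1 (heq ▸ h2.2.symm)]
  rw [card_compl, hCcard, Fintype.card_fin] at hcard
  omega

/-- Jensen's inequality for the concave logarithm with uniform weights. -/
theorem sum_log_one_add_degree_le (G : SimpleGraph (Fin K)) [DecidableRel G.Adj] (hK : 0 < K) :
    ∑ k, Real.log (1 + G.degree k) ≤ K * Real.log (1 + avgDegree G) := by
  have hK' : (0 : ℝ) < K := by exact_mod_cast hK
  have h := strictConcaveOn_log_Ioi.concaveOn.le_map_sum (t := univ) (w := fun _ : Fin K ↦ (K : ℝ)⁻¹)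
    (p := fun k ↦ 1 + (G.degree k : ℝ)) (fun _ _ ↦ by positivity)
    (by simp [hK'.ne']) (fun k _ ↦ by simp only [Set.mem_Ioi]; positivity)
  simp only [smul_eq_mul, ← mul_sum] at h
  have h2 : (K : ℝ)⁻¹ * ∑ k, (1 + (G.degree k : ℝ)) = 1 + avgDegree G := by
    rw [sum_add_distrib, avgDegree]
    simp only [sum_const, card_univ, Fintype.card_fin, nsmul_eq_mul, mul_one]
    field_simp
  rw [h2, inv_mul_le_iff₀ hK'] at h
  exact h

/-- Since `log 2 > 2/3`, a constant cost per agent can be charged to the logarithmic term. -/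
theorem two_thirds_mul_le_sum_log_one_add_degree (hdeg : ∀ k, 1 ≤ G.degree k) :
    2 / 3 * (K : ℝ) ≤ ∑ k, Real.log (1 + G.degree k) := by
  have : ∀ k ∈ (univ : Finset (Fin K)), (2 / 3 : ℝ) ≤ Real.log (1 + G.degree k) := by
    intro k _
    have h1 : (1 : ℝ) ≤ G.degree k := by exact_mod_cast hdeg k
    have h2 := Real.log_le_log (by norm_num) (show (2 : ℝ) ≤ 1 + G.degree k by linarith)
    linarith [Real.log_two_gt_d9]
  have h3 := sum_le_sum this
  simp only [sum_const, card_univ, Fintype.card_fin, nsmul_eq_mul] at h3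
  linarith

end Graph

/-! ### Case analysis and the leading constant -/

section Regret

variable {Ω : Type u} {K N m : ℕ} [mΩ : MeasurableSpace Ω] {P : Measure Ω}
  {ℱ : Filtration ℕ mΩ} {G : SimpleGraph (Fin K)} [DecidableRel G.Adj] {p ξ : ℝ}
  {ν : Fin N → Measure ℝ} {σ : Fin N → ℝ≥0}
  {X : ℕ → Fin K → Fin N → Ω → ℝ} {φ : ℕ → Fin K → Ω → Fin N}
  {I : ℕ → Fin K → Fin K → Ω → Bool}

/-- The absolute constant in front of the part of the regret that does not grow with the
horizon. -/
noncomputable def regretConst : ℝ :=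
  2 * Real.exp (10 ^ 6) + 60305 + 12 * ∑' t : ℕ, (t : ℝ) ^ (-(5 / 4) : ℝ)

theorem tsum_rpow_nonneg : 0 ≤ ∑' t : ℕ, (t : ℝ) ^ (-(5 / 4) : ℝ) :=
  tsum_nonneg fun t ↦ by positivity

theorem regretConst_pos : 0 < regretConst := by
  have := tsum_rpow_nonneg
  unfold regretConst
  positivity

/-- The group total of the choices of a suboptimal option when the leading constant is comparable
to the number of agents: no use of the communication is needed. -/
theorem sum_integral_numChoices_le_of_le [IsProbabilityMeasure P]
    (hν : IsSubgaussianBandit ν σ) (h : IsBroadcastBandit P ℱ G p ν X φ I) {α : Fin K → ℝ}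
    (hU : FollowsUCB σ α ξ X φ I) (hα : ∀ k, 0 ≤ α k) (hξ : 1 < ξ) (hK : 0 < K)
    {i j : Fin N} {D : ℝ} (hD : 0 < D) (hij : meanReward ν j = meanReward ν i + D)
    (hdeg : ∀ k, 1 ≤ G.degree k) (T : ℕ) {c : ℝ} (hc : ∑ k, (1 + α k) ≤ 3.9 * c) :
    ∑ k, ∫ ω, (numChoices φ k i T ω : ℝ) ∂P ≤
      c * (8 * ((σ i : ℝ) ^ 2 / D ^ 2) * (ξ + 1) * Real.log T) +
      regretConst * (K * Real.log (1 + avgDegree G)) := by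
  set s := ∑' t : ℕ, (t : ℝ) ^ (-(5 / 4) : ℝ) with hs
  have hs0 : 0 ≤ s := tsum_rpow_nonneg
  set u := (σ i : ℝ) ^ 2 / D ^ 2 with hu
  have hu0 : 0 ≤ u := by positivity
  set Λ := ∑ k, Real.log (1 + G.degree k) with hΛ
  have hΛ1 : Λ ≤ K * Real.log (1 + avgDegree G) := sum_log_one_add_degree_le G hK
  have hΛ2 : 2 / 3 * (K : ℝ) ≤ Λ := two_thirds_mul_le_sum_log_one_add_degree hdeg
  have hK0 : (0 : ℝ) ≤ K := Nat.cast_nonneg K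
  have hKc : (K : ℝ) ≤ 3.9 * c := by
    refine le_trans ?_ hc
    have : ∑ k : Fin K, (1 : ℝ) ≤ ∑ k, (1 + α k) :=
      sum_le_sum fun k _ ↦ by linarith [hα k]
    simpa using this
  have hc0 : 0 ≤ c := by linarith
  have hlT := Real.log_natCast_nonneg T
  have he : 0 < Real.exp (10 ^ 6) := Real.exp_pos _
  have hconst : regretConst * Λ ≤ regretConst * (K * Real.log (1 + avgDegree G)) :=
    mul_le_mul_of_nonneg_left hΛ1 regretConst_pos.le
  refine le_trans ?_ (add_le_add_right hconst _)
  have hC : regretConst * Λ =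
      2 * (Real.exp (10 ^ 6) * Λ) + 60305 * Λ + 12 * (s * Λ) := by
    rw [regretConst]; ring
  have hsΛ : 0 ≤ s * Λ := mul_nonneg hs0 (by linarith)
  have heΛ : 0 ≤ Real.exp (10 ^ 6) * Λ := mul_nonneg he.le (by linarith)
  rw [hC]
  -- For short horizons the trivial bound `T` per agent is a constant. For long ones `log T ≥ 10⁶`
  -- lets the leading term absorb the multiple of `σ²/D²` left by overestimation.
  rcases lt_or_ge (T : ℝ) (Real.exp (10 ^ 6)) with hT | hT
  · have h1 : ∑ k, ∫ ω, (numChoices φ k i T ω : ℝ) ∂P ≤ ∑ k : Fin K, Real.exp (10 ^ 6) :=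
      sum_le_sum fun k _ ↦ (integral_numChoices_le_horizon k i T).trans hT.le
    rw [sum_const, card_univ, Fintype.card_fin, nsmul_eq_mul] at h1
    have h2 : 0 ≤ c * (8 * u * (ξ + 1) * Real.log T) := by positivity
    nlinarith
  · have hT0 : (0 : ℝ) < T := he.trans_le hT
    have hlog : 10 ^ 6 ≤ Real.log T := (Real.le_log_iff_exp_le hT0).2 hT
    have h1 : ∀ k ∈ (univ : Finset (Fin K)), ∫ ω, (numChoices φ k i T ω : ℝ) ∂P ≤
        (1 + α k) * threshold 1.01 u ξ T + 12 * s * Real.log (1 + G.degree k) +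
        (1 + 20402 * u) := by
      intro k _
      -- The choice `a = 1.01` gives `2a² = 2.0402` and `2a²/(a - 1)² = 20402`.
      have := integral_numChoices_le hν h hU (hα k) hξ hD hij (a := 1.01) (by norm_num)
        (hdeg k) T
      rw [← hu, ← hs] at this
      norm_num at this ⊢
      linarith
    refine (sum_le_sum h1).trans ?_
    rw [sum_add_distrib, sum_add_distrib, ← sum_mul, ← mul_sum, ← hΛ, sum_const, card_univ,
      Fintype.card_fin, nsmul_eq_mul]
    have h2 : (∑ k, (1 + α k)) * threshold 1.01 u ξ T ≤ 3.9 * c * threshold 1.01 u ξ T :=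
      mul_le_mul_of_nonneg_right hc (threshold_nonneg hu0 hξ T)
    have h3 : threshold 1.01 u ξ T = 2.0402 * (u * ((ξ + 1) * Real.log T)) := by
      rw [threshold]; ring
    set W := (ξ + 1) * Real.log T with hW
    have hW1 : 2 * 10 ^ 6 ≤ W := by
      rw [hW]; nlinarith
    -- The available room is `8 - 3.9 · 2.0402 = 0.04322`.
    have h4 : (K : ℝ) * u * (20402 : ℝ) ≤ 0.04322 * (c * u * W) := by
      have h5 : (K : ℝ) * u ≤ 3.9 * c * u := mul_le_mul_of_nonneg_right hKc hu0
      have h6 : c * u * (2 * 10 ^ 6) ≤ c * u * W := mul_le_mul_of_nonneg_left hW1 (by positivity)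
      nlinarith [mul_nonneg hc0 hu0]
    rw [h3] at h2 ⊢
    have h7 : c * (8 * u * (ξ + 1) * Real.log T) = 8 * (c * u * W) := by rw [hW]; ring
    rw [h7]
    have h8 : 3.9 * c * (2.0402 * (u * W)) = 7.95678 * (c * u * W) := by ring
    rw [h8] at h2
    have h9 : 12 * s * Λ = 12 * (s * Λ) := by ring
    have h10 : (K : ℝ) * (1 + 20402 * u) = K + K * u * 20402 := by ring
    rw [h9, h10]
    generalize (∑ k, (1 + α k)) * (2.0402 * (u * W)) = Y at *
    generalize c * u * W = Z at *
    generalize Real.exp (10 ^ 6) * Λ = E at *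
    generalize s * Λ = F at *
    generalize (K : ℝ) * u * 20402 = H at *
    linarith

/-- The group total of the choices of a suboptimal option. -/
theorem sum_integral_numChoices_le [IsProbabilityMeasure P] (hK : 2 ≤ K)
    (hG : IsSymmetricMultiStar G m) (hp0 : 0 ≤ p) (hp1 : p ≤ 1) (hξ : 1 < ξ)
    (hν : IsSubgaussianBandit ν σ) (h : IsBroadcastBandit P ℱ G p ν X φ I)
    (hU : FollowsUCB σ (explorationBias G m p) ξ X φ I)
    {i j : Fin N} {D : ℝ} (hD : 0 < D) (hij : meanReward ν j = meanReward ν i + D)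
    {T : ℕ} (hT : 1 ≤ T) {α : ℝ} (hα : 0 ≤ α) :
    ∑ k, ∫ ω, (numChoices φ k i T ω : ℝ) ∂P ≤
      c₁ K m α p * (8 * ((σ i : ℝ) ^ 2 / D ^ 2) * (ξ + 1) * Real.log T) +
      regretConst * (K * Real.log (1 + avgDegree G)) := by
  have hdeg := hG.one_le_degree hK
  have hK' : (2 : ℝ) ≤ K := by exact_mod_cast hK
  have hm1 : (1 : ℝ) ≤ m := by exact_mod_cast hG.one_le
  have hden : 0 < 1 + p * ((m : ℝ) - 1) := by
    have := mul_nonneg hp0 (sub_nonneg.2 hm1)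
    linarith
  rcases Nat.lt_or_ge m K with hmK | hmK
  · refine sum_integral_numChoices_le_of_le hν h hU (hG.explorationBias_nonneg hK hp0) hξ
      (by omega) hD hij hdeg T ?_
    have h1 : ∑ k, (1 + explorationBias G m p k) ≤ ∑ k : Fin K, (1 + if k.val < m then 1 else 0) := by
      refine sum_le_sum fun k _ ↦ ?_
      by_cases hk : k.val < m
      · rw [if_pos hk]; linarith [hG.explorationBias_le_one hK hp0 hp1 k]
      · simp [explorationBias, hk]
    have h2 : ∑ k : Fin K, ((1 : ℝ) + if k.val < m then 1 else 0) = K + m := by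
      rw [sum_add_distrib, ← sum_filter]
      have h3 : (univ.filter fun k : Fin K ↦ k.val < m) = Finset.Iio ⟨m, hmK⟩ := by
        ext k; simp [Fin.lt_def]
      rw [h3]
      simp
    have h4 : (2 : ℝ) * m ≤ K := by exact_mod_cast hG.two_mul_le hmK
    have h5 : (K : ℝ) - m ≤ c₁ K m α p := by
      unfold c₁
      have : 0 ≤ m * (1 + α) / (1 + p * ((m : ℝ) - 1)) * max (1 - p * (((K : ℝ) - m) / m)) 0 :=
        mul_nonneg (by positivity) (le_max_right _ _)
      linarith
    linarith
  · obtain rfl : m = K := le_antisymm hG.le_card hmK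
    have hα0 := hG.explorationBias_eq_zero hK p
    have hc1 : (m : ℝ) / (1 + p * ((m : ℝ) - 1)) ≤ c₁ m m α p := by
      unfold c₁
      simp only [sub_self, zero_div, mul_zero, sub_zero, zero_add]
      rw [max_eq_left zero_le_one, mul_one]
      gcongr
      exact le_mul_of_one_le_right (by positivity) (by linarith)
    -- At most `2.9`, the denominator `1 + p(m - 1)` is at most `3.9`, and own samples suffice; this
    -- includes `p = 0`.
    rcases le_or_gt (p * m) 2.9 with hpm | hpm
    · refine sum_integral_numChoices_le_of_le hν h hU (fun k ↦ (hα0 k).ge) hξ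
        (by omega) hD hij hdeg T ?_
      simp only [hα0, add_zero, sum_const, card_univ, Fintype.card_fin, nsmul_eq_mul, mul_one]
      refine le_trans ?_ (mul_le_mul_of_nonneg_left hc1 (by norm_num))
      rw [mul_div_assoc', le_div_iff₀ hden]
      nlinarith
    · have hp : 0 < p := by
        rcases hp0.eq_or_lt with h0 | h0
        · rw [← h0] at hpm; norm_num at hpm
        · exact h0
      have hadj : ∀ k j, k ≠ j → G.Adj k j := fun k j ↦ hG.center_adj k j k.2 j.2
      -- Here `a = 1.71` is just large enough for `(a - 1)² ≥ 1/2`.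
      have key := sum_integral_numChoices_le_of_complete hν hp hp1 hadj h hU hα0 hξ hD hij
        (a := 1.71) (by norm_num) (by norm_num) hdeg hT
      set s := ∑' t : ℕ, (t : ℝ) ^ (-(5 / 4) : ℝ) with hs
      have hs0 : 0 ≤ s := tsum_rpow_nonneg
      set u := (σ i : ℝ) ^ 2 / D ^ 2 with hu
      have hu0 : 0 ≤ u := by positivity
      have hlT := Real.log_natCast_nonneg T
      rw [← mul_sum] at key
      set Λ := ∑ k, Real.log (1 + G.degree k) with hΛ
      have hΛ1 : Λ ≤ m * Real.log (1 + avgDegree G) := sum_log_one_add_degree_le G (by omega)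
      have hΛ2 : 2 / 3 * (m : ℝ) ≤ Λ := two_thirds_mul_le_sum_log_one_add_degree hdeg
      have hconst : regretConst * Λ ≤ regretConst * (m * Real.log (1 + avgDegree G)) :=
        mul_le_mul_of_nonneg_left hΛ1 regretConst_pos.le
      have hC : regretConst * Λ =
          2 * (Real.exp (10 ^ 6) * Λ) + 60305 * Λ + 12 * (s * Λ) := by
        rw [regretConst]; ring
      have heΛ : 0 ≤ Real.exp (10 ^ 6) * Λ := mul_nonneg (Real.exp_nonneg _) (by linarith)
      have hlead : 1.01 * threshold 1.71 u ξ T / p ≤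
          c₁ m m α p * (8 * u * (ξ + 1) * Real.log T) := by
        refine le_trans ?_ (mul_le_mul_of_nonneg_right hc1 (by positivity))
        have h3 : 1.01 * threshold 1.71 u ξ T / p =
            (5.906682 / p) * (u * (ξ + 1) * Real.log T) := by
          rw [threshold]; ring
        have h4 : (m : ℝ) / (1 + p * ((m : ℝ) - 1)) * (8 * u * (ξ + 1) * Real.log T) =
            (8 * m / (1 + p * ((m : ℝ) - 1))) * (u * (ξ + 1) * Real.log T) := by ring
        rw [h3, h4]
        refine mul_le_mul_of_nonneg_right ?_ (by positivity)
        -- It suffices that `5.906682 ≤ (8 - 5.906682) · pm`, which holds for `pm > 2.9`; the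
        -- constant is `1.01 · 2 · 1.71²`.
        rw [div_le_div_iff₀ hp hden]
        nlinarith
      nlinarith

end Regret

end MultiStar

/-! ### Assembly of the regret bound -/

theorem theorem1 :
    ∃ ζ : ℝ, 1 < ζ ∧
      ∀ (Ω : Type u) [mΩ : MeasurableSpace Ω] (P : Measure Ω) [IsProbabilityMeasure P]
        (ℱ : Filtration ℕ mΩ) (K N m : ℕ) (G : SimpleGraph (Fin K)) [DecidableRel G.Adj]
        (p ξ : ℝ) (ν : Fin N → Measure ℝ) (σ : Fin N → ℝ≥0)
        (X : ℕ → Fin K → Fin N → Ω → ℝ) (φ : ℕ → Fin K → Ω → Fin N)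
        (I : ℕ → Fin K → Fin K → Ω → Bool) (T : ℕ),
        2 ≤ K → MultiStar.IsSymmetricMultiStar G m →
        0 ≤ p → p ≤ 1 → 1 < ξ →
        MultiStar.IsSubgaussianBandit ν σ →
        MultiStar.IsBroadcastBandit P ℱ G p ν X φ I →
        MultiStar.FollowsUCB σ (MultiStar.explorationBias G m p) ξ X φ I →
        1 ≤ T →
        ∀ (c : Fin K), c.val < m → ∀ (α dcen : ℝ),
          α = MultiStar.explorationBias G m p c →
          dcen = ((K : ℝ) - m) / m + m - 1 →
          MultiStar.expectedRegret P ν φ T ≤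
            MultiStar.c₁ K m α p *
                ∑ i ∈ Finset.univ.filter (fun i : Fin N ↦ 0 < MultiStar.gap ν i),
                  8 * (σ i : ℝ) ^ 2 * (ξ + 1) * Real.log T / MultiStar.gap ν i
              + 2 / Real.log ζ * ∑ i : Fin N, MultiStar.gap ν i *
                  (K * Real.log (1 + MultiStar.avgDegree G)
                    + ((K : ℝ) - m) * ((ξ * Real.log 4 + 1) / (ξ ^ 2 * 2 ^ ξ))
                    + m * ((Real.log (2 * (1 + dcen)) * (ξ * α + ξ + α) + 1)
                        / ((ξ * α + ξ + α) ^ 2 * (2 : ℝ) ^ (ξ * α + ξ + α)))) := by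
  -- This `ζ` makes `2 / log ζ` equal to `regretConst`.
  refine ⟨Real.exp (2 / MultiStar.regretConst),
    Real.one_lt_exp_iff.2 (div_pos two_pos MultiStar.regretConst_pos), ?_⟩
  intro Ω mΩ P _ ℱ K N m G _ p ξ ν σ X φ I T hK hG hp0 hp1 hξ hν h hU hT c hc α dcen hα hdcen
  have hC := MultiStar.regretConst_pos
  rw [Real.log_exp, div_div_cancel₀ two_ne_zero]
  set C := MultiStar.regretConst
  have hα0 : 0 ≤ α := hα ▸ hG.explorationBias_nonneg hK hp0 c
  have hK' : (m : ℝ) ≤ K := by exact_mod_cast hG.le_card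
  have hm1 : (1 : ℝ) ≤ m := by exact_mod_cast hG.one_le
  have hm0 : (0 : ℝ) < m := by linarith
  have hd0 : 0 ≤ dcen := by
    rw [hdcen]
    have := div_nonneg (sub_nonneg.2 hK') hm0.le
    linarith
  have hgap : ∀ i, 0 ≤ MultiStar.gap ν i := fun i ↦
    sub_nonneg.2 (le_ciSup (Set.finite_range _).bddAbove i)
  set R : ℝ := ((K : ℝ) - m) * ((ξ * Real.log 4 + 1) / (ξ ^ 2 * 2 ^ ξ))
    + m * ((Real.log (2 * (1 + dcen)) * (ξ * α + ξ + α) + 1)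
      / ((ξ * α + ξ + α) ^ 2 * (2 : ℝ) ^ (ξ * α + ξ + α))) with hR
  have hR0 : 0 ≤ R := by
    have h1 : 0 ≤ Real.log 4 := Real.log_nonneg (by norm_num)
    have h2 : 0 ≤ Real.log (2 * (1 + dcen)) := Real.log_nonneg (by linarith)
    have h3 := sub_nonneg.2 hK'
    have h4 : 0 ≤ ξ := by linarith
    positivity
  set c₁ := MultiStar.c₁ K m α p
  set A : ℝ := K * Real.log (1 + MultiStar.avgDegree G) with hA
  have hterm : ∀ i : Fin N, ∑ k, MultiStar.gap ν i *
      ∫ ω, (MultiStar.numChoices φ k i T ω : ℝ) ∂P ≤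
      c₁ * (if 0 < MultiStar.gap ν i then
        8 * (σ i : ℝ) ^ 2 * (ξ + 1) * Real.log T / MultiStar.gap ν i else 0) +
      C * (MultiStar.gap ν i * (A + R)) := by
    intro i
    rcases (hgap i).eq_or_lt with h0 | h0
    · simp [← h0]
    · rw [if_pos h0, ← Finset.mul_sum]
      have : Nonempty (Fin N) := ⟨i⟩
      obtain ⟨j, hj⟩ := exists_eq_ciSup_of_finite (f := MultiStar.meanReward ν)
      have hij : MultiStar.meanReward ν j = MultiStar.meanReward ν i + MultiStar.gap ν i := by
        rw [MultiStar.gap, hj]; ring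
      have key := MultiStar.sum_integral_numChoices_le hK hG hp0 hp1 hξ hν h hU h0 hij hT hα0
      calc _ ≤ MultiStar.gap ν i * (c₁ * (8 * ((σ i : ℝ) ^ 2 / MultiStar.gap ν i ^ 2) * (ξ + 1) *
            Real.log T) + C * A) := mul_le_mul_of_nonneg_left key h0.le
        _ = c₁ * (8 * (σ i : ℝ) ^ 2 * (ξ + 1) * Real.log T / MultiStar.gap ν i) +
            C * (MultiStar.gap ν i * A) := by field_simp
        _ ≤ _ := by
          gcongr
          -- Here the nonnegative remainder `R` is added for free.
          linarith
  refine (Finset.sum_le_sum fun i _ ↦ hterm i).trans (le_of_eq ?_)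
  rw [Finset.sum_add_distrib, ← Finset.mul_sum, ← Finset.mul_sum, Finset.sum_filter]
  simp only [hR, add_assoc]
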